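/- Let $\mathbb{T}=\mathbb{R}/\mathbb{Z}$ and let $\varphi:\mathbb{T}\to(0,\infty)$ be a $C^3$ function with Fourier coefficients $c_m$, so that $\varphi(x)=\sum_{m\in\mathbb{Z}}c_me^{2\pi i m x}$. Suppose that [H1] there are real numbers $C_m$ $(m\ge 1)$ with $\sum_{m\ge1}|C_m|<\infty$ and $\sum_{l=2}^\infty|c_{lm}|^2\le C_m|c_m|^2$ for all sufficiently large $m$; [H2] there is $0<K_1<1/4$ with $\sum_{l=2}^\infty|c_{lm}|\le K_1|c_m|$ for all sufficiently large $m$; [H3] there is $K_2>0$ with $\sum_{l=2}^\infty l\,|c_{lm}|\le K_2|c_m|$ for all sufficiently large $m$. For $\alpha\in\mathbb{R}\setminus\mathbb{Q}$ let $T^t_{(\alpha,\varphi)}$ be the special flow over the rotation $R_\alpha:x\mapsto x+\alpha$ under $\varphi$, that is, the vertical unit speed flow on $\{(x,s):x\in\mathbb{T},\ 0\le s<\varphi(x)\}$, where $(x,\varphi(x))$ is identified with $(x+\alpha,0)$, with Lebesgue measure. Then for every irrational $\alpha$ exactly one of the following holds: 1. $T^t_{(\alpha,\varphi)}$ is weak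 mixing, i.e. its only $L^2$ eigenfunctions are the constants; 2. $T^t_{(\alpha,\varphi)}$ is $L^2$-conjugate to a suspension flow, i.e. there are a constant $c>0$ and a function $\psi\in L^2(\mathbb{T})$ such that $(x,s)\mapsto(x,s+\psi(x))$, taken modulo the identification $(x,s+c)\sim(x+\alpha,s)$, is an isomorphism mod $0$ of measure-preserving flows from $T^t_{(\alpha,\varphi)}$ to the special flow $T^t_{(\alpha,c)}$ over $R_\alpha$ under the constant $c$. Moreover, 2 holds if and only if the formal solution of the additive cohomological equation $\psi(x+\alpha)-\psi(x)=\varphi(x)-c_0$ is square-summable, i.e. $$\sum_{m\in\mathbb{Z}\setminus\{0\}}\Bigl|\frac{c_m}{e^{2\pi i m\alpha}-1}\Bigr|^2<\infty .$$ -/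

import Mathlib

open MeasureTheory Filter

noncomputable section

namespace SpecialFlow

/-- The Birkhoff sums `S_n φ(x)` over the rotation `x ↦ x + α` of `𝕋 = ℝ/ℤ`, for all integers `n`:
`S_n φ(x) = φ(x) + φ(x + α) + ⋯ + φ(x + (n-1)α)` for `n ≥ 0` and
`S_{-n} φ(x) = -(φ(x - α) + ⋯ + φ(x - nα))` for `n ≥ 1`. -/
def birkhoff (α : ℝ) (φ : UnitAddCircle → ℝ) : ℤ → UnitAddCircle → ℝ
  | Int.ofNat n, x => ∑ k ∈ Finset.range n, φ (x + (((k : ℝ) * α : ℝ) : UnitAddCircle))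
  | Int.negSucc n, x =>
      -∑ k ∈ Finset.range (n + 1), φ (x - ((((k : ℝ) + 1) * α : ℝ) : UnitAddCircle))

/-- The largest integer `n` with `S_n φ(x) ≤ u`. When `φ` is continuous and positive, it is the
unique integer `n` with `S_n φ(x) ≤ u < S_{n+1} φ(x)`. -/
def returnIndex (α : ℝ) (φ : UnitAddCircle → ℝ) (x : UnitAddCircle) (u : ℝ) : ℤ :=
  sSup {n : ℤ | birkhoff α φ n x ≤ u}

/-- The projection of `𝕋 × ℝ` onto the region `{(x, s) : 0 ≤ s < φ x}` under the graph of `φ`,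
along the identification `(x, s + φ x) ∼ (x + α, s)`. -/
def proj (α : ℝ) (φ : UnitAddCircle → ℝ) (p : UnitAddCircle × ℝ) : UnitAddCircle × ℝ :=
  (p.1 + (((returnIndex α φ p.1 p.2 : ℝ) * α : ℝ) : UnitAddCircle),
    p.2 - birkhoff α φ (returnIndex α φ p.1 p.2) p.1)

/-- The special flow over the rotation by `α` under the function `φ`: vertical motion at unit speed
in the region under the graph of `φ`, where `(x, φ x)` is identified with `(x + α, 0)`. -/
def flow (α : ℝ) (φ : UnitAddCircle → ℝ) (t : ℝ) (p : UnitAddCircle × ℝ) : UnitAddCircle × ℝ :=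
  proj α φ (p.1, p.2 + t)

/-- The phase space of the special flow under `φ`. -/
def region (φ : UnitAddCircle → ℝ) : Set (UnitAddCircle × ℝ) :=
  {p | 0 ≤ p.2 ∧ p.2 < φ p.1}

/-- The invariant measure of the special flow under `φ`: Lebesgue measure on its phase space. -/
def flowMeasure (φ : UnitAddCircle → ℝ) : Measure (UnitAddCircle × ℝ) :=
  (volume : Measure (UnitAddCircle × ℝ)).restrict (region φ)

/-- A flow is weak mixing if it has continuous spectrum: every `L²` eigenfunction, for whatever
eigenvalue (`0` included), is almost everywhere constant. -/
def WeakMixing {X : Type*} [MeasurableSpace X] (T : ℝ → X → X) (μ : Measure X) : Prop :=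
  ∀ (ν : ℝ) (f : X → ℂ), MemLp f 2 μ →
    (∀ t : ℝ, ∀ᵐ p ∂μ,
      f (T t p) = Complex.exp (2 * Real.pi * Complex.I * ν * t) * f p) →
    ∃ k : ℂ, ∀ᵐ p ∂μ, f p = k

/-- Measurable conjugacy of measure-preserving flows: `h` is an isomorphism of measure spaces mod 0
that intertwines the flows. -/
def IsConjugacy {X Y : Type*} [MeasurableSpace X] [MeasurableSpace Y]
    (T : ℝ → X → X) (μ : Measure X) (S : ℝ → Y → Y) (ν : Measure Y) (h : X → Y) : Prop :=
  MeasurePreserving h μ ν ∧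
  (∃ g : Y → X, MeasurePreserving g ν μ ∧
    (∀ᵐ p ∂μ, g (h p) = p) ∧ (∀ᵐ q ∂ν, h (g q) = q)) ∧
  ∀ t : ℝ, ∀ᵐ p ∂μ, h (T t p) = S t (h p)

/-- `L²` conjugacy of the special flows under `φ₁` and `φ₂` over the same rotation: they are
conjugate by a map that displaces the orbit of `(x, 0)` by a time `ψ x`, with `ψ` in `L²(𝕋)`;
that is, `(x, s)` is sent to the class of `(x, s + ψ x)`. -/
def L2Conjugate (α : ℝ) (φ₁ φ₂ : UnitAddCircle → ℝ) : Prop :=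
  ∃ (h : UnitAddCircle × ℝ → UnitAddCircle × ℝ) (ψ : UnitAddCircle → ℝ),
    IsConjugacy (flow α φ₁) (flowMeasure φ₁) (flow α φ₂) (flowMeasure φ₂) h ∧
    MemLp ψ 2 volume ∧
    ∀ᵐ p ∂(flowMeasure φ₁), h p = proj α φ₂ (p.1, p.2 + ψ p.1)

/-- `L²` conjugacy to a suspension flow, i.e. to a special flow under a positive constant. -/
def L2ConjugateToSuspension (α : ℝ) (φ : UnitAddCircle → ℝ) : Prop :=
  ∃ c : ℝ, 0 < c ∧ L2Conjugate α φ (fun _ => c)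

/-- The Fourier coefficients `c_m` of `φ`. -/
def coeff (φ : UnitAddCircle → ℝ) (m : ℤ) : ℂ :=
  fourierCoeff (fun x : UnitAddCircle => (φ x : ℂ)) m

/-- Condition [H1]. -/
def H1 (φ : UnitAddCircle → ℝ) : Prop :=
  ∃ C : ℕ → ℝ, Summable C ∧ ∀ᶠ m : ℕ in atTop,
    ∑' l : ℕ, ‖coeff φ ((l + 2) * m)‖ ^ 2 ≤ C m * ‖coeff φ m‖ ^ 2

/-- Condition [H2]. -/
def H2 (φ : UnitAddCircle → ℝ) : Prop :=
  ∃ K : ℝ, 0 < K ∧ K < 1 / 4 ∧ ∀ᶠ m : ℕ in atTop,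
    ∑' l : ℕ, ‖coeff φ ((l + 2) * m)‖ ≤ K * ‖coeff φ m‖

/-- Condition [H3]. -/
def H3 (φ : UnitAddCircle → ℝ) : Prop :=
  ∃ K : ℝ, 0 < K ∧ ∀ᶠ m : ℕ in atTop,
    ∑' l : ℕ, ((l : ℝ) + 2) * ‖coeff φ ((l + 2) * m)‖ ≤ K * ‖coeff φ m‖

/-- The Fourier coefficients of the formal solution `ψ` (of mean zero) of
`ψ(x + α) - ψ(x) = φ(x) - c_0`. -/
def formalCoeff (α : ℝ) (φ : UnitAddCircle → ℝ) (m : ℤ) : ℂ :=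
  if m = 0 then 0 else coeff φ m / (Complex.exp (2 * Real.pi * Complex.I * m * α) - 1)

end SpecialFlow

end

noncomputable section

namespace SpecialFlow

/-! ### The norm on the circle and rational approximation -/

lemma exists_coe_eq_of_norm (θ : UnitAddCircle) : ∃ t : ℝ, (t : UnitAddCircle) = θ ∧ |t| = ‖θ‖ := by
  induction θ using QuotientAddGroup.induction_on with
  | H x =>
    refine ⟨x - round x, ?_, (UnitAddCircle.norm_eq).symm⟩
    have h : ((round x : ℝ) : UnitAddCircle) = 0 := by
      have := AddCircle.coe_eq_zero_iff (1 : ℝ) (x := (round x : ℝ))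
      exact this.2 ⟨round x, by simp⟩
    rw [AddCircle.coe_sub, h, sub_zero]

lemma norm_circle_le_half (θ : UnitAddCircle) : ‖θ‖ ≤ 1 / 2 := by
  have := AddCircle.norm_le_half_period (1 : ℝ) (x := θ) one_ne_zero
  simpa using this

lemma norm_coe_le_abs (t : ℝ) : ‖(t : UnitAddCircle)‖ ≤ |t| := by
  rw [UnitAddCircle.norm_eq]
  simpa using round_le t 0

lemma norm_coe_eq_abs {t : ℝ} (ht : |t| ≤ 1 / 2) : ‖(t : UnitAddCircle)‖ = |t| := by
  rw [AddCircle.norm_coe_eq_abs_iff (1 : ℝ) one_ne_zero]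
  simpa using ht

lemma norm_nsmul_eq {θ : UnitAddCircle} {n : ℕ} (h : n * ‖θ‖ ≤ 1 / 2) : ‖n • θ‖ = n * ‖θ‖ := by
  obtain ⟨t, rfl, ht⟩ := exists_coe_eq_of_norm θ
  rw [← AddCircle.coe_nsmul, norm_coe_eq_abs] <;> rw [nsmul_eq_mul, abs_mul, Nat.abs_cast, ht]
  exact h

lemma norm_fourier_sub_one_aux (θ : UnitAddCircle) :
    ‖(fourier 1 θ : ℂ) - 1‖ ≤ 2 * Real.pi * ‖θ‖ ∧ 4 * ‖θ‖ ≤ ‖(fourier 1 θ : ℂ) - 1‖ := by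
  obtain ⟨t, rfl, ht⟩ := exists_coe_eq_of_norm θ
  have h : (fourier 1 (t : UnitAddCircle) : ℂ) = Complex.exp (Complex.I * ((2 * Real.pi * t : ℝ))) := by
    rw [fourier_coe_apply]
    congr 1
    push_cast
    ring
  have h2 := norm_circle_le_half (t : UnitAddCircle)
  rw [← ht] at h2 ⊢
  rw [h]
  constructor
  · refine Real.norm_exp_I_mul_ofReal_sub_one_le.trans ?_
    rw [Real.norm_eq_abs, abs_mul, abs_of_pos Real.two_pi_pos]
  · rw [Complex.norm_exp_I_mul_ofReal_sub_one, norm_mul, Real.norm_eq_abs, Real.norm_eq_abs]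
    have h3 : 2 * Real.pi * t / 2 = Real.pi * t := by ring
    have h4 : |Real.pi * t| = Real.pi * |t| := by rw [abs_mul, abs_of_pos Real.pi_pos]
    have := Real.mul_abs_le_abs_sin (x := Real.pi * t) (by rw [h4]; nlinarith [Real.pi_pos])
    rw [h3, abs_two]
    have h5 : 2 / Real.pi * |Real.pi * t| = 2 * |t| := by
      rw [h4]; field_simp
    linarith

lemma norm_fourier_sub_one_le (m : ℤ) (θ : UnitAddCircle) :
    ‖(fourier m θ : ℂ) - 1‖ ≤ 2 * Real.pi * ‖m • θ‖ := by
  have := (norm_fourier_sub_one_aux (m • θ)).1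
  simpa [fourier_apply] using this

lemma le_norm_fourier_sub_one (m : ℤ) (θ : UnitAddCircle) :
    4 * ‖m • θ‖ ≤ ‖(fourier m θ : ℂ) - 1‖ := by
  have := (norm_fourier_sub_one_aux (m • θ)).2
  simpa [fourier_apply] using this

lemma norm_fourier_apply (m : ℤ) (x : UnitAddCircle) : ‖(fourier m x : ℂ)‖ = 1 := by
  rw [fourier_apply]; exact Circle.norm_coe _

lemma fourier_add_apply (m : ℤ) (x y : UnitAddCircle) :
    (fourier m (x + y) : ℂ) = fourier m x * fourier m y := by
  simp [fourier_apply, smul_add, AddCircle.toCircle_add]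

lemma fourier_nsmul_apply (m : ℤ) (k : ℕ) (x : UnitAddCircle) :
    (fourier m (k • x) : ℂ) = (fourier m x : ℂ) ^ k := by
  simp [fourier_apply, smul_comm m k x, AddCircle.toCircle_nsmul]

lemma norm_zsmul_pos {α : ℝ} (hα : Irrational α) {m : ℤ} (hm : m ≠ 0) :
    0 < ‖m • (α : UnitAddCircle)‖ := by
  rw [norm_pos_iff, ← AddCircle.coe_zsmul, Ne, AddCircle.coe_eq_zero_iff]
  rintro ⟨n, hn⟩
  simp only [zsmul_eq_mul, mul_one] at hn
  exact (hα.intCast_mul hm).ne_int n hn.symm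

lemma norm_nsmul_pos {α : ℝ} (hα : Irrational α) {m : ℕ} (hm : m ≠ 0) :
    0 < ‖m • (α : UnitAddCircle)‖ := by
  simpa using norm_zsmul_pos hα (m := m) (by exact_mod_cast hm)

lemma fourier_ne_one {α : ℝ} (hα : Irrational α) {m : ℤ} (hm : m ≠ 0) :
    (fourier m (α : UnitAddCircle) : ℂ) - 1 ≠ 0 := by
  rw [← norm_pos_iff]
  linarith [le_norm_fourier_sub_one m (α : UnitAddCircle), norm_zsmul_pos hα hm]

/-- A denominator `q` of a reduced fraction `p / q` with `|q α - p| < q⁻²`. -/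
structure IsGoodDenom (α : ℝ) (q : ℕ) : Prop where
  pos : 0 < q
  close : ‖q • (α : UnitAddCircle)‖ < 1 / (q : ℝ) ^ 2
  coprime : ∃ p : ℤ, IsCoprime p (q : ℤ) ∧ ‖q • (α : UnitAddCircle)‖ = |q * α - p|

lemma IsGoodDenom.norm_ge {α : ℝ} {q : ℕ} (hq : IsGoodDenom α q) {m : ℕ} (hm : ¬ q ∣ m)
    (h : m * ‖q • (α : UnitAddCircle)‖ ≤ 1 / 2) : 1 / (2 * q) ≤ ‖m • (α : UnitAddCircle)‖ := by
  obtain ⟨p, hp, hn⟩ := hq.coprime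
  have hq0 : (0 : ℝ) < q := by exact_mod_cast hq.pos
  have e : ‖m • (α : UnitAddCircle)‖ = |m * α - round (m * α)| := by
    rw [← AddCircle.coe_nsmul, nsmul_eq_mul, UnitAddCircle.norm_eq]
  set P := round ((m : ℝ) * α)
  have hne : (m : ℤ) * p - P * q ≠ 0 := by
    intro h0
    apply hm
    have : (q : ℤ) ∣ m * p := ⟨P, by linarith⟩
    exact_mod_cast hp.symm.dvd_of_dvd_mul_right this
  have h1 : (1 : ℝ) ≤ |(m : ℝ) * p - P * q| := by
    exact_mod_cast Int.one_le_abs hne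
  have h2 : (m : ℝ) * p - P * q = q * (m * α - P) - m * (q * α - p) := by ring
  have h3 : |(m : ℝ) * p - P * q| ≤ q * |m * α - P| + m * |q * α - p| := by
    rw [h2]
    refine (abs_sub _ _).trans ?_
    rw [abs_mul, abs_mul, Nat.abs_cast, Nat.abs_cast]
  rw [e, div_le_iff₀ (by positivity)]
  rw [hn] at h
  linarith

lemma IsGoodDenom.norm_ge_of_lt {α : ℝ} {p q : ℕ} (hp : IsGoodDenom α p) (hq : IsGoodDenom α q)
    (hpq : p < q) : 1 / (2 * q) ≤ ‖p • (α : UnitAddCircle)‖ := by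
  refine hq.norm_ge (Nat.not_dvd_of_pos_of_lt hp.pos hpq) ?_
  have hp0 : (1 : ℝ) ≤ p := by exact_mod_cast hp.pos
  have hq2 : (p : ℝ) + 1 ≤ q := by exact_mod_cast hpq
  have h2 : (0 : ℝ) < (q : ℝ) ^ 2 := pow_pos (by linarith) 2
  calc (p : ℝ) * ‖q • (α : UnitAddCircle)‖ ≤ p * (1 / (q : ℝ) ^ 2) := by gcongr; exact hq.close.le
    _ ≤ 1 / 2 := by
      rw [mul_one_div, div_le_div_iff₀ h2 two_pos]
      nlinarith

lemma IsGoodDenom.sq_lt {α : ℝ} {p q : ℕ} (hp : IsGoodDenom α p) (hq : IsGoodDenom α q)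
    (hpq : p < q) : (p : ℝ) ^ 2 < 2 * q := by
  have h1 := hp.norm_ge_of_lt hq hpq
  have h2 := h1.trans_lt hp.close
  have hp0 : (0 : ℝ) < p := by exact_mod_cast hp.pos
  have hq0 : (0 : ℝ) < q := by exact_mod_cast hq.pos
  rw [div_lt_div_iff₀ (by positivity) (by positivity)] at h2
  linarith

/-- A very good denominator is a multiple of a reduced one. -/
lemma exists_isGoodDenom {α : ℝ} {m : ℕ} (hm : 0 < m)
    (h : ‖m • (α : UnitAddCircle)‖ < 1 / (m : ℝ) ^ 2) :
    ∃ q l : ℕ, IsGoodDenom α q ∧ 0 < l ∧ m = l * q ∧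
      ‖m • (α : UnitAddCircle)‖ = l * ‖q • (α : UnitAddCircle)‖ := by
  have e : ‖m • (α : UnitAddCircle)‖ = |m * α - round (m * α)| := by
    rw [← AddCircle.coe_nsmul, nsmul_eq_mul, UnitAddCircle.norm_eq]
  have hhalf := norm_circle_le_half (m • (α : UnitAddCircle))
  set P := round ((m : ℝ) * α)
  set d := Int.gcd P m with hd
  have hd0 : 0 < d := Int.gcd_pos_of_ne_zero_right _ (by exact_mod_cast hm.ne')
  obtain ⟨p, hp⟩ : (d : ℤ) ∣ P := Int.gcd_dvd_left ..
  obtain ⟨q, hq⟩ : d ∣ m := by exact_mod_cast (Int.gcd_dvd_right .. : (Int.gcd P m : ℤ) ∣ m)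
  have hq0 : 0 < q := Nat.pos_of_ne_zero (by rintro rfl; simp at hq; omega)
  have hcop : IsCoprime p (q : ℤ) := by
    rw [Int.isCoprime_iff_gcd_eq_one]
    have : d * Int.gcd p q = d * 1 := by
      conv_rhs => rw [mul_one, hd, hp, hq]
      push_cast
      rw [Int.gcd_mul_left]
      simp
    exact Nat.eq_of_mul_eq_mul_left hd0 this
  have h1 : |(m : ℝ) * α - P| = d * |q * α - p| := by
    rw [hp, hq]
    push_cast
    rw [← Nat.abs_cast d, ← abs_mul, Nat.abs_cast]
    ring_nf
  have hd1 : (1 : ℝ) ≤ d := by exact_mod_cast hd0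
  have h2 : |(q : ℝ) * α - p| ≤ |m * α - P| := by
    rw [h1]; nlinarith [abs_nonneg ((q : ℝ) * α - p)]
  have h3 : ‖q • (α : UnitAddCircle)‖ = |q * α - p| := by
    rw [← norm_coe_eq_abs (h2.trans (e ▸ hhalf)), AddCircle.coe_sub]
    have : ((p : ℝ) : UnitAddCircle) = 0 := (AddCircle.coe_eq_zero_iff (1 : ℝ)).2 ⟨p, by simp⟩
    rw [this, sub_zero, ← AddCircle.coe_nsmul, nsmul_eq_mul]
  refine ⟨q, d, ⟨hq0, ?_, p, hcop, h3⟩, hd0, hq, by rw [e, h1, h3]⟩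
  rw [h3]
  refine (h2.trans_eq e.symm).trans_lt (h.trans_le ?_)
  have hqm : q ≤ m := by rw [hq]; exact Nat.le_mul_of_pos_left _ hd0
  gcongr

/-! ### Sums over sparse sets of denominators -/

lemma sum_sq_le_of_goodDenom {α : ℝ} (F : Finset ℕ) :
    ∀ q : ℕ, IsGoodDenom α q → (∀ p ∈ F, IsGoodDenom α p ∧ 32 ≤ p ∧ p < q) →
    (∑ p ∈ F, (p : ℝ)) ≤ 3 * √q := by
  induction F using Finset.induction_on_max with
  | empty => intro q _ _; simp
  | insert p s hs ih =>
    intro q hq hF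
    obtain ⟨hp, h32, hpq⟩ := hF p (Finset.mem_insert_self _ _)
    have h32' : (32 : ℝ) ≤ p := by exact_mod_cast h32
    have h1 := ih p hp fun r hr => by
      obtain ⟨h1, h2, h3⟩ := hF r (Finset.mem_insert_of_mem hr)
      exact ⟨h1, h2, hs r hr⟩
    rw [Finset.sum_insert (fun h => (hs p h).false)]
    have h2 : 3 * √(p : ℝ) ≤ p := by
      have : √(p : ℝ) * √(p : ℝ) = p := Real.mul_self_sqrt (by positivity)
      have h5 : 3 ≤ √(p : ℝ) := by
        apply Real.le_sqrt_of_sq_le; linarith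
      nlinarith
    have h3 : 2 * (p : ℝ) ≤ 3 * √q := by
      have h4 := hp.sq_lt hq hpq
      have : √(q : ℝ) ^ 2 = q := Real.sq_sqrt (by positivity)
      nlinarith [Real.sqrt_nonneg (q : ℝ)]
    linarith

lemma sum_inv_sqrt_le_of_goodDenom {α : ℝ} (F : Finset ℕ) :
    ∀ J : ℕ, 32 ≤ J → (∀ p ∈ F, IsGoodDenom α p ∧ J ≤ p) →
    (∑ p ∈ F, 1 / √(p : ℝ)) ≤ 2 / √J := by
  induction F using Finset.induction_on_min with
  | empty => intro J _ _; simp; positivity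
  | insert p s hs ih =>
    intro J hJ hF
    obtain ⟨hp, hJp⟩ := hF p (Finset.mem_insert_self _ _)
    have h32 : (32 : ℝ) ≤ p := by exact_mod_cast hJ.trans hJp
    have h1 := ih (4 * p) (by omega) fun r hr => by
      obtain ⟨h1, h2⟩ := hF r (Finset.mem_insert_of_mem hr)
      refine ⟨h1, ?_⟩
      have := hp.sq_lt h1 (hs r hr)
      have h3 : (4 * p : ℝ) ≤ r := by nlinarith
      exact_mod_cast h3
    rw [Finset.sum_insert (fun h => (hs p h).false)]
    have h2 : √((4 * p : ℕ) : ℝ) = 2 * √p := by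
      push_cast
      rw [Real.sqrt_mul (by norm_num), show (4 : ℝ) = 2 ^ 2 by norm_num, Real.sqrt_sq (by norm_num)]
    have hJ0 : (0 : ℝ) < J := by
      have : 0 < J := by omega
      exact_mod_cast this
    have h3 : √(J : ℝ) ≤ √p := Real.sqrt_le_sqrt (by exact_mod_cast hJp)
    have h4 : 0 < √(J : ℝ) := Real.sqrt_pos.2 hJ0
    rw [h2] at h1
    calc 1 / √(p : ℝ) + ∑ x ∈ s, 1 / √(x : ℝ) ≤ 1 / √(p : ℝ) + 2 / (2 * √p) := by linarith
      _ = 2 / √(p : ℝ) := by field_simp; norm_num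
      _ ≤ 2 / √J := by gcongr

/-! ### Geometric sums of characters -/

/-- The geometric sum `∑_{k < N} e^{2 π i m k a}`. -/
def geomChar (a : UnitAddCircle) (N : ℕ) (m : ℤ) : ℂ :=
  ∑ k ∈ Finset.range N, (fourier m (k • a) : ℂ)

lemma norm_geomChar_le (a : UnitAddCircle) (N : ℕ) (m : ℤ) : ‖geomChar a N m‖ ≤ N := by
  refine (norm_sum_le _ _).trans ?_
  simp only [norm_fourier_apply, Finset.sum_const, Finset.card_range, nsmul_eq_mul, mul_one, le_refl]

lemma geomChar_mul (a : UnitAddCircle) (N : ℕ) (m : ℤ) :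
    geomChar a N m * (fourier m a - 1) = fourier m (N • a) - 1 := by
  simp only [geomChar, fourier_nsmul_apply]
  exact geom_sum_mul _ _

lemma norm_geomChar_mul_le (a : UnitAddCircle) (N : ℕ) (m : ℤ) :
    ‖geomChar a N m‖ * ‖m • a‖ ≤ 2 * |(m : ℝ)| * ‖N • a‖ := by
  have h1 := congrArg norm (geomChar_mul a N m)
  rw [norm_mul] at h1
  have h2 := le_norm_fourier_sub_one m a
  have h3 := norm_fourier_sub_one_le m (N • a)
  have h4 : ‖m • (N • a)‖ ≤ |(m : ℝ)| * ‖N • a‖ := by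
    simpa [Int.norm_eq_abs] using norm_zsmul_le m (N • a)
  have h5 : ‖geomChar a N m‖ * (4 * ‖m • a‖) ≤ 8 * (|(m : ℝ)| * ‖N • a‖) := by
    calc _ ≤ ‖geomChar a N m‖ * ‖(fourier m a : ℂ) - 1‖ := by gcongr
      _ ≤ 2 * Real.pi * ‖m • (N • a)‖ := h1.trans_le h3
      _ ≤ 8 * (|(m : ℝ)| * ‖N • a‖) := by
        have := Real.pi_lt_d2
        gcongr
        linarith
  linarith

lemma le_norm_geomChar {a : UnitAddCircle} {N q : ℕ} (h : N * ‖q • a‖ ≤ 1 / 2) (ha : 0 < ‖q • a‖) :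
    (N : ℝ) / 2 ≤ ‖geomChar a N q‖ := by
  have h1 := congrArg norm (geomChar_mul a N q)
  rw [norm_mul] at h1
  have h2 := norm_fourier_sub_one_le q a
  have h3 := le_norm_fourier_sub_one q (N • a)
  rw [smul_comm, natCast_zsmul, norm_nsmul_eq h] at h3
  rw [natCast_zsmul] at h2
  have h4 : 4 * (N * ‖q • a‖) ≤ ‖geomChar a N q‖ * (8 * ‖q • a‖) := by
    refine h3.trans (h1.symm.le.trans ?_)
    gcongr
    refine h2.trans ?_
    have := Real.pi_lt_d2
    gcongr
    linarith
  have h5 : (N / 2 : ℝ) * (8 * ‖q • a‖) ≤ ‖geomChar a N q‖ * (8 * ‖q • a‖) := by linarith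
  exact le_of_mul_le_mul_right h5 (by positivity)

/-! ### Fourier series on the circle -/

lemma volume_eq_haarAddCircle : (volume : Measure UnitAddCircle) = AddCircle.haarAddCircle := by
  rw [AddCircle.volume_eq_smul_haarAddCircle]; simp

instance isProbabilityMeasure_volume_circle :
    IsProbabilityMeasure (volume : Measure UnitAddCircle) :=
  ⟨UnitAddCircle.measure_univ⟩

lemma fourierCoeff_eq (f : UnitAddCircle → ℂ) (m : ℤ) :
    fourierCoeff f m = ∫ x, (fourier (-m) x : ℂ) * f x := by
  rw [fourierCoeff, volume_eq_haarAddCircle]; rfl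

lemma integral_fourier (m : ℤ) : ∫ x : UnitAddCircle, (fourier m x : ℂ) = if m = 0 then 1 else 0 := by
  have h := congrFun (fourierCoeff_fourier (T := 1) m) 0
  rw [fourierCoeff_eq] at h
  simp only [neg_zero, fourier_zero, one_mul] at h
  rw [h, Pi.single_apply]
  simp only [eq_comm]

lemma fourierCoeff_translate (f : UnitAddCircle → ℂ) (b : UnitAddCircle) (m : ℤ) :
    fourierCoeff (fun x => f (x + b)) m = fourier m b * fourierCoeff f m := by
  rw [fourierCoeff_eq, fourierCoeff_eq, ← integral_add_right_eq_self (fun x => _ * f x) b,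
    ← integral_const_mul]
  congr 1
  ext x
  rw [fourier_add_apply, fourier_neg, fourier_neg]
  have h : (fourier m b : ℂ) * (starRingEnd ℂ) (fourier m b) = 1 := by
    rw [Complex.mul_conj, Complex.normSq_eq_norm_sq, norm_fourier_apply]; simp
  linear_combination (- (starRingEnd ℂ) (fourier m x : ℂ) * f (x + b)) * h

lemma fourierCoeff_sub' {f g : UnitAddCircle → ℂ} (hf : Integrable f) (hg : Integrable g) (m : ℤ) :
    fourierCoeff (fun x => f x - g x) m = fourierCoeff f m - fourierCoeff g m := by
  simp only [fourierCoeff_eq, mul_sub]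
  rw [volume_eq_haarAddCircle] at *
  exact integral_sub (hf.fourier_smul (-m)) (hg.fourier_smul (-m))

lemma fourierCoeff_sum' {ι : Type*} (s : Finset ι) {f : ι → UnitAddCircle → ℂ}
    (hf : ∀ i ∈ s, Integrable (f i)) (m : ℤ) :
    fourierCoeff (fun x => ∑ i ∈ s, f i x) m = ∑ i ∈ s, fourierCoeff (f i) m := by
  simp only [fourierCoeff_eq, Finset.mul_sum]
  rw [volume_eq_haarAddCircle] at *
  exact integral_finsetSum _ fun i hi => (hf i hi).fourier_smul (-m)

lemma fourierCoeff_const' (c : ℂ) (m : ℤ) :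
    fourierCoeff (fun _ : UnitAddCircle => c) m = if m = 0 then c else 0 := by
  rw [fourierCoeff_eq, integral_mul_const, integral_fourier]
  simp

lemma fourierCoeff_conj (f : UnitAddCircle → ℝ) (m : ℤ) :
    fourierCoeff (fun x => (f x : ℂ)) (-m)
      = (starRingEnd ℂ) (fourierCoeff (fun x => (f x : ℂ)) m) := by
  rw [fourierCoeff_eq, fourierCoeff_eq, ← integral_conj]
  congr 1
  ext x
  simp

lemma norm_coeff_neg (f : UnitAddCircle → ℝ) (m : ℤ) : ‖coeff f (-m)‖ = ‖coeff f m‖ := by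
  rw [coeff, coeff, fourierCoeff_conj, Complex.norm_conj]

/-- Parseval's identity. -/
lemma hasSum_sq_norm_fourierCoeff {f : UnitAddCircle → ℂ} (hf : MemLp f 2 volume) :
    HasSum (fun m => ‖fourierCoeff f m‖ ^ 2) (∫ x, ‖f x‖ ^ 2) := by
  rw [volume_eq_haarAddCircle] at *
  have h := hasSum_sq_fourierCoeff (hf.toLp f)
  rw [fourierCoeff_congr_ae hf.coeFn_toLp] at h
  convert h using 1
  refine integral_congr_ae ?_
  filter_upwards [hf.coeFn_toLp] with x hx
  rw [hx]

lemma ae_eq_of_fourierCoeff_eq {f g : UnitAddCircle → ℂ} (hf : MemLp f 2 volume)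
    (hg : MemLp g 2 volume) (h : ∀ m, fourierCoeff f m = fourierCoeff g m) : f =ᵐ[volume] g := by
  rw [volume_eq_haarAddCircle] at *
  have h2 : hf.toLp f = hg.toLp g := by
    apply fourierBasis.repr.injective
    ext m
    rw [fourierBasis_repr, fourierBasis_repr, fourierCoeff_congr_ae hf.coeFn_toLp,
      fourierCoeff_congr_ae hg.coeFn_toLp, h]
  filter_upwards [hf.coeFn_toLp, hg.coeFn_toLp] with x hx hy
  rw [← hx, ← hy, h2]

lemma exists_memLp_fourierCoeff_eq {c : ℤ → ℂ} (hc : Summable fun m => ‖c m‖ ^ 2) :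
    ∃ f : UnitAddCircle → ℂ, StronglyMeasurable f ∧ MemLp f 2 volume ∧
      ∀ m, fourierCoeff f m = c m := by
  have hmem : Memℓp c 2 := by
    rw [memℓp_gen_iff (by norm_num)]
    simpa using hc
  set F := (fourierBasis (T := 1)).repr.symm (⟨c, hmem⟩ : lp (fun _ : ℤ => ℂ) 2) with hF
  refine ⟨F, Lp.stronglyMeasurable F, ?_, fun m => ?_⟩
  · rw [volume_eq_haarAddCircle]; exact Lp.memLp F
  · rw [← fourierBasis_repr, hF, LinearIsometryEquiv.apply_symm_apply]

lemma formalCoeff_eq (α : ℝ) (f : UnitAddCircle → ℝ) (m : ℤ) :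
    formalCoeff α f m
      = if m = 0 then 0 else coeff f m / ((fourier m (α : UnitAddCircle) : ℂ) - 1) := by
  rw [formalCoeff, fourier_coe_apply]
  simp

lemma memLp_two_ofReal {f : UnitAddCircle → ℝ} (hf : MemLp f 2 volume) :
    MemLp (fun x => (f x : ℂ)) 2 volume := hf.ofReal

lemma measurePreserving_rotation (a : UnitAddCircle) :
    MeasurePreserving (fun x : UnitAddCircle => x + a) volume volume :=
  measurePreserving_add_right volume a

/-- A square-summable formal solution of the cohomological equation is a solution. -/
lemma exists_coboundary {α : ℝ} (hα : Irrational α) {f : UnitAddCircle → ℝ} (hf : MemLp f 2 volume)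
    (h : Summable fun m : ℤ => ‖formalCoeff α f m‖ ^ 2) :
    ∃ ψ : UnitAddCircle → ℝ, Measurable ψ ∧ MemLp ψ 2 volume ∧
      ∀ᵐ x, ψ (x + (α : UnitAddCircle)) - ψ x = f x - (coeff f 0).re := by
  obtain ⟨Ψ, hΨm, hΨ, hc⟩ := exists_memLp_fourierCoeff_eq h
  have hΨt : MemLp (fun x => Ψ (x + (α : UnitAddCircle))) 2 volume :=
    hΨ.comp_measurePreserving (measurePreserving_rotation _)
  have key := ae_eq_of_fourierCoeff_eq (hΨt.sub hΨ)
    ((memLp_two_ofReal hf).sub (memLp_const (coeff f 0))) (fun m => by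
      have e1 := fourierCoeff_sub' (hΨt.integrable (by norm_num)) (hΨ.integrable (by norm_num)) m
      have e2 := fourierCoeff_sub' ((memLp_two_ofReal hf).integrable (by norm_num))
        (integrable_const (coeff f 0)) m
      refine e1.trans (Eq.trans ?_ e2.symm)
      rw [fourierCoeff_translate, hc, fourierCoeff_const', formalCoeff_eq]
      split_ifs with hm
      · subst hm; simp [coeff]
      · have := fourier_ne_one hα hm
        rw [sub_zero, ← sub_one_mul, mul_div_cancel₀ _ this, coeff])
  refine ⟨fun x => (Ψ x).re, Complex.measurable_re.comp hΨm.measurable, hΨ.re, ?_⟩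
  filter_upwards [key] with x hx
  have := congrArg Complex.re hx
  simpa using this

/-- An `L²` solution of the cohomological equation is the formal one, up to a constant. -/
lemma summable_of_coboundary {α : ℝ} (hα : Irrational α) {f ψ : UnitAddCircle → ℝ}
    (hf : MemLp f 2 volume) (hψ : MemLp ψ 2 volume) {c : ℝ}
    (h : ∀ᵐ x, ψ (x + (α : UnitAddCircle)) - ψ x = f x - c) :
    Summable fun m : ℤ => ‖formalCoeff α f m‖ ^ 2 := by
  have hψc := memLp_two_ofReal hψ
  have hψt : MemLp (fun x => (ψ (x + (α : UnitAddCircle)) : ℂ)) 2 volume :=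
    hψc.comp_measurePreserving (measurePreserving_rotation _)
  have hs := (hasSum_sq_norm_fourierCoeff hψc).summable
  refine hs.of_nonneg_of_le (fun _ => by positivity) fun m => ?_
  rw [formalCoeff_eq]
  split_ifs with hm
  · simp
  · have e1 := fourierCoeff_sub' (hψt.integrable (by norm_num)) (hψc.integrable (by norm_num)) m
    have e2 := fourierCoeff_sub' ((memLp_two_ofReal hf).integrable (by norm_num))
        (integrable_const (c : ℂ)) m
    have e3 : fourierCoeff (fun x => (ψ (x + (α : UnitAddCircle)) : ℂ) - ψ x) m
        = fourierCoeff (fun x => (f x : ℂ) - c) m := by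
      rw [fourierCoeff_eq, fourierCoeff_eq]
      refine integral_congr_ae ?_
      filter_upwards [h] with x hx
      congr 1
      exact_mod_cast hx
    have e4 := fourierCoeff_translate (fun x => (ψ x : ℂ)) α m
    rw [e1, e2, fourierCoeff_const', if_neg hm, sub_zero, e4, ← sub_one_mul] at e3
    rw [coeff, ← e3, mul_div_cancel_left₀ _ (fourier_ne_one hα hm)]

/-! ### Decay of Fourier coefficients -/

lemma continuous_of_continuous_coe {E : Type*} [TopologicalSpace E] {f : UnitAddCircle → E}
    (h : Continuous fun x : ℝ => f (x : UnitAddCircle)) : Continuous f :=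
  (QuotientAddGroup.isQuotientMap_mk _).continuous_iff.2 h

lemma norm_fourierCoeffOn_mul_le {f : ℝ → ℂ} (hf : ContDiff ℝ 1 f) (hper : f 1 = f 0) (n : ℤ) :
    ‖fourierCoeffOn zero_lt_one f n‖ * |(n : ℝ)| ≤ ‖fourierCoeffOn zero_lt_one (deriv f) n‖ := by
  by_cases hn : n = 0
  · simp [hn]
  have h := fourierCoeffOn_of_hasDerivAt (zero_lt_one (α := ℝ)) hn
    (fun x _ => (hf.differentiable (by norm_num) x).hasDerivAt)
    ((hf.continuous_deriv (by norm_num)).intervalIntegrable 0 1)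
  rw [h, hper]
  have hn' : 0 < |(n : ℝ)| := by
    rw [abs_pos]; exact_mod_cast hn
  simp only [sub_self, mul_zero, Complex.ofReal_one, Complex.ofReal_zero, sub_zero, one_mul,
    zero_sub, norm_mul, norm_neg, norm_div, norm_one, Complex.norm_I, mul_one,
    Complex.norm_real, Real.norm_eq_abs, Complex.norm_intCast, abs_of_pos Real.pi_pos,
    Complex.norm_two]
  have e : ∀ y : ℝ, 1 / (2 * Real.pi * |(n : ℝ)|) * y * |(n : ℝ)| = (2 * Real.pi)⁻¹ * y := by
    intro y
    field_simp
  rw [e]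
  have : (2 * Real.pi)⁻¹ ≤ 1 := inv_le_one_of_one_le₀ (by linarith [Real.pi_gt_three])
  exact mul_le_of_le_one_left (norm_nonneg _) this

lemma exists_coeff_le {f : UnitAddCircle → ℝ}
    (hf : ContDiff ℝ 3 (fun x : ℝ => f (x : UnitAddCircle))) :
    ∃ C : ℝ, 0 < C ∧ ∀ m : ℤ, ‖coeff f m‖ * |(m : ℝ)| ^ 3 ≤ C := by
  set g : ℝ → ℂ := fun x => (f (x : UnitAddCircle) : ℂ) with hg
  have hg3 : ContDiff ℝ 3 g := Complex.ofRealCLM.contDiff.comp hf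
  have hp : Function.Periodic g 1 := fun x => by simp [hg]
  have hderiv_per : ∀ u : ℝ → ℂ, Function.Periodic u 1 → Function.Periodic (deriv u) 1 := by
    intro u hu x
    rw [← deriv_comp_add_const]
    congr 1
    exact funext hu
  have h1 : ContDiff ℝ 2 (deriv g) := by
    have := (contDiff_succ_iff_deriv (n := 2) (f := g)).1 (by exact_mod_cast hg3)
    exact this.2.2
  have h2 : ContDiff ℝ 1 (deriv (deriv g)) := by
    have := (contDiff_succ_iff_deriv (n := 1) (f := deriv g)).1 (by exact_mod_cast h1)
    exact this.2.2
  have h3 : Continuous (deriv (deriv (deriv g))) := h2.continuous_deriv (by norm_num)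
  have hp1 := hderiv_per _ hp
  have hp2 := hderiv_per _ hp1
  obtain ⟨C, hC⟩ := (isCompact_Icc (a := (0 : ℝ)) (b := 1)).exists_bound_of_continuousOn h3.continuousOn
  refine ⟨max C 1, by positivity, fun m => ?_⟩
  have e : coeff f m = fourierCoeffOn zero_lt_one g m := by
    rw [coeff, fourierCoeff_eq_intervalIntegral _ _ 0, fourierCoeffOn_eq_integral]
    simp [hg]
  have k1 := norm_fourierCoeffOn_mul_le (hg3.of_le (by norm_num)) (by simpa using hp 0) m
  have k2 := norm_fourierCoeffOn_mul_le (h1.of_le (by norm_num)) (by simpa using hp1 0) m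
  have k3 := norm_fourierCoeffOn_mul_le h2 (by simpa using hp2 0) m
  have k4 : ‖fourierCoeffOn zero_lt_one (deriv (deriv (deriv g))) m‖ ≤ C := by
    rw [fourierCoeffOn_eq_integral]
    simp only [sub_zero, div_one, one_smul]
    have := intervalIntegral.norm_integral_le_of_norm_le_const (a := 0) (b := 1) (C := C)
      (f := fun x : ℝ => (fourier (-m) (x : AddCircle (1 - 0 : ℝ)) : ℂ) • deriv (deriv (deriv g)) x)
      (fun x hx => by
        rw [norm_smul, fourier_apply, Circle.norm_coe, one_mul]
        rw [Set.uIoc_of_le zero_le_one] at hx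
        exact hC x ⟨hx.1.le, hx.2⟩)
    simpa using this
  rw [e]
  have hm := abs_nonneg (m : ℝ)
  calc _ = ‖fourierCoeffOn zero_lt_one g m‖ * |(m : ℝ)| * |(m : ℝ)| * |(m : ℝ)| := by ring
    _ ≤ ‖fourierCoeffOn zero_lt_one (deriv g) m‖ * |(m : ℝ)| * |(m : ℝ)| := by gcongr
    _ ≤ ‖fourierCoeffOn zero_lt_one (deriv (deriv g)) m‖ * |(m : ℝ)| := by gcongr
    _ ≤ _ := k3
    _ ≤ _ := k4.trans (le_max_left _ _)

/-! ### Correlations of a function with its translates -/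

lemma tendsto_integral_translate_mul_conj {G : UnitAddCircle → ℂ} (hG : Measurable G)
    (h1 : ∀ᵐ x, ‖G x‖ = 1) :
    Tendsto (fun y : UnitAddCircle => ∫ x, G (x + y) * (starRingEnd ℂ) (G x)) (nhds 0) (nhds 1) := by
  have hG2 : MemLp G 2 volume :=
    MemLp.of_bound hG.aestronglyMeasurable 1 (h1.mono fun x hx => hx.le)
  set g := hG2.toLp G with hg
  have : Fact ((2 : ENNReal) ≠ ⊤) := ⟨by norm_num⟩
  have hcont : Continuous fun y : UnitAddCircle => inner ℂ g (DomAddAct.mk y +ᵥ g) := by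
    refine continuous_const.inner ?_
    exact (continuous_vadd (M := (UnitAddCircleᵈᵃᵃ)) (X := Lp ℂ 2 (volume : Measure UnitAddCircle))).comp
      ((DomAddAct.continuous_mk).prodMk continuous_const)
  have heq : ∀ y, inner ℂ g (DomAddAct.mk y +ᵥ g) = ∫ x, G (x + y) * (starRingEnd ℂ) (G x) := by
    intro y
    rw [L2.inner_def]
    refine integral_congr_ae ?_
    have hq := DomAddAct.vadd_Lp_ae_eq (DomAddAct.mk y) g
    have hq2 := (measurePreserving_add_left (volume : Measure UnitAddCircle) y).quasiMeasurePreserving.ae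
      hG2.coeFn_toLp
    filter_upwards [hq, hG2.coeFn_toLp, hq2] with x hx1 hx2 hx3
    rw [hx1, hx2]
    simp only [Equiv.symm_apply_apply, vadd_eq_add]
    rw [hx3, add_comm y x]
    simp
  have h0 : ∫ x, G (x + 0) * (starRingEnd ℂ) (G x) = 1 := by
    have : ∫ x : UnitAddCircle, (1 : ℂ) = 1 := by simp
    rw [← this]
    refine integral_congr_ae ?_
    filter_upwards [h1] with x hx
    rw [add_zero, Complex.mul_conj, Complex.normSq_eq_norm_sq, hx]; simp
  have := hcont.tendsto 0
  simp only [heq] at this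
  rwa [h0] at this

/-! ### Oscillatory integrals -/

/-- The integral of `e^{2 π i ν F}` over the circle. -/
def expInt (ν : ℝ) (F : UnitAddCircle → ℝ) : ℂ :=
  ∫ x, Complex.exp (2 * Real.pi * Complex.I * ν * F x)

lemma exp_eq (ν t : ℝ) : Complex.exp (2 * Real.pi * Complex.I * ν * t)
    = Complex.exp (Complex.I * ((2 * Real.pi * ν * t : ℝ))) := by
  congr 1; push_cast; ring

lemma norm_exp_eq_one (ν t : ℝ) : ‖Complex.exp (2 * Real.pi * Complex.I * ν * t)‖ = 1 := by
  rw [exp_eq, Complex.norm_exp_I_mul_ofReal]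

lemma norm_exp_sub_exp_le (ν s t : ℝ) :
    ‖Complex.exp (2 * Real.pi * Complex.I * ν * s) - Complex.exp (2 * Real.pi * Complex.I * ν * t)‖
      ≤ 2 * Real.pi * |ν| * |s - t| := by
  have h : Complex.exp (2 * Real.pi * Complex.I * ν * s)
      - Complex.exp (2 * Real.pi * Complex.I * ν * t)
      = Complex.exp (2 * Real.pi * Complex.I * ν * t)
        * (Complex.exp (2 * Real.pi * Complex.I * ν * (s - t : ℝ)) - 1) := by
    rw [mul_sub, ← Complex.exp_add]
    push_cast
    ring_nf
  rw [h, norm_mul, norm_exp_eq_one, one_mul, exp_eq]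
  refine Real.norm_exp_I_mul_ofReal_sub_one_le.trans ?_
  rw [Real.norm_eq_abs, abs_mul, abs_mul, abs_of_pos Real.two_pi_pos]

lemma continuous_exp_comp {F : UnitAddCircle → ℝ} (hF : Continuous F) (ν : ℝ) :
    Continuous fun x => Complex.exp (2 * Real.pi * Complex.I * ν * F x) := by fun_prop

lemma integrable_of_continuous {E : Type*} [NormedAddCommGroup E] {f : UnitAddCircle → E}
    (hf : Continuous f) : Integrable f :=
  hf.integrable_of_hasCompactSupport (HasCompactSupport.of_compactSpace f)

lemma memLp_two_of_continuous {f : UnitAddCircle → ℝ} (hf : Continuous f) : MemLp f 2 volume :=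
  hf.memLp_of_hasCompactSupport (HasCompactSupport.of_compactSpace f)

lemma norm_expInt_add_const (ν : ℝ) (F : UnitAddCircle → ℝ) (c : ℝ) :
    ‖expInt ν (fun x => F x + c)‖ = ‖expInt ν F‖ := by
  have : expInt ν (fun x => F x + c)
      = expInt ν F * Complex.exp (2 * Real.pi * Complex.I * ν * c) := by
    rw [expInt, expInt, ← integral_mul_const]
    congr 1
    ext x
    rw [← Complex.exp_add]
    push_cast
    ring_nf
  rw [this, norm_mul, norm_exp_eq_one, mul_one]

lemma norm_expInt_le_add {F Z : UnitAddCircle → ℝ} (hF : Continuous F) (hZ : Continuous Z) (ν : ℝ) :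
    ‖expInt ν F‖ ≤ ‖expInt ν Z‖ + 2 * Real.pi * |ν| * ∫ x, |F x - Z x| := by
  have h : expInt ν F = expInt ν Z + ∫ x, (Complex.exp (2 * Real.pi * Complex.I * ν * F x)
      - Complex.exp (2 * Real.pi * Complex.I * ν * Z x)) := by
    rw [integral_sub (integrable_of_continuous (continuous_exp_comp hF ν))
      (integrable_of_continuous (continuous_exp_comp hZ ν)), expInt, expInt]
    ring
  rw [h]
  refine (norm_add_le _ _).trans ?_
  gcongr
  rw [← integral_const_mul]
  refine norm_integral_le_of_norm_le ?_ (Eventually.of_forall fun x => norm_exp_sub_exp_le ν _ _)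
  exact (integrable_of_continuous (hF.sub hZ).abs).const_mul _

lemma integral_abs_le {F : UnitAddCircle → ℝ} (hF : Continuous F) {s : ℝ} (hs : 0 < s)
    (h : ∫ x, F x ^ 2 ≤ s ^ 2) : ∫ x, |F x| ≤ s := by
  have h1 : ∫ x, |F x| ≤ ∫ x, (F x ^ 2 / s + s) / 2 := by
    refine integral_mono (integrable_of_continuous hF.abs)
      (integrable_of_continuous (by fun_prop)) fun x => ?_
    have e : F x ^ 2 / s = s * (|F x| / s) ^ 2 := by
      rw [div_pow, sq_abs]; field_simp
    have e2 : |F x| = s * (|F x| / s) := by field_simp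
    simp only
    rw [e]
    nth_rewrite 1 [e2]
    nlinarith [sq_nonneg (|F x| / s - 1)]
  refine h1.trans ?_
  rw [integral_div, integral_add (integrable_of_continuous (by fun_prop)) (integrable_const _),
    integral_div, integral_const]
  simp only [probReal_univ, one_smul]
  have : (∫ x, F x ^ 2) / s ≤ s := by
    rw [div_le_iff₀ hs]; linarith
  linarith

/-! ### Elementary waves -/

/-- The real trigonometric monomial `2 Re (w e^{2 π i q x})`. -/
def wave (w : ℂ) (q : ℤ) (x : UnitAddCircle) : ℝ := 2 * (w * fourier q x).re

lemma continuous_wave (w : ℂ) (q : ℤ) : Continuous (wave w q) := by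
  unfold wave; fun_prop

lemma wave_coe (w : ℂ) (q : ℤ) (x : UnitAddCircle) :
    (wave w q x : ℂ) = w * fourier q x + (starRingEnd ℂ) w * fourier (-q) x := by
  rw [wave, fourier_neg, ← map_mul, Complex.add_conj]

lemma abs_wave_le (w : ℂ) (q : ℤ) (x : UnitAddCircle) : |wave w q x| ≤ 2 * ‖w‖ := by
  rw [wave, abs_mul, abs_two]
  have := Complex.abs_re_le_norm (w * fourier q x)
  rw [norm_mul, norm_fourier_apply, mul_one] at this
  linarith

lemma wave_add (w : ℂ) (q : ℤ) (x b : UnitAddCircle) :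
    wave w q (x + b) = wave (w * fourier q b) q x := by
  rw [wave, wave, fourier_add_apply]
  ring_nf

lemma abs_wave_sub_le (w : ℂ) (q : ℕ) (x y : UnitAddCircle) :
    |wave w q x - wave w q y| ≤ 16 * ‖w‖ * q * ‖x - y‖ := by
  have h1 : wave w q x - wave w q y = wave (w * (fourier (q : ℤ) (x - y) - 1)) q y := by
    nth_rewrite 1 [← sub_add_cancel x y]
    rw [add_comm, wave_add, wave, wave, wave, mul_sub, sub_mul, Complex.sub_re]
    ring_nf
  rw [h1]
  refine (abs_wave_le _ _ _).trans ?_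
  rw [norm_mul]
  have h2 := norm_fourier_sub_one_le q (x - y)
  have h3 : ‖(q : ℤ) • (x - y)‖ ≤ q * ‖x - y‖ := by
    rw [natCast_zsmul]
    simpa using norm_nsmul_le (n := q) (a := x - y)
  have h4 : ‖(fourier (q : ℤ) (x - y) : ℂ) - 1‖ ≤ 8 * (q * ‖x - y‖) := by
    refine h2.trans ?_
    have := Real.pi_lt_d2
    gcongr
    linarith
  nlinarith [mul_le_mul_of_nonneg_left h4 (norm_nonneg w)]

lemma fourierCoeff_wave (w : ℂ) {q : ℤ} (hq : q ≠ 0) (m : ℤ) :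
    coeff (wave w q) m = if m = q then w else if m = -q then (starRingEnd ℂ) w else 0 := by
  rw [coeff, fourierCoeff_eq]
  have h : ∀ x : UnitAddCircle, (fourier (-m) x : ℂ) * (wave w q x : ℂ)
      = w * fourier (-m + q) x + (starRingEnd ℂ) w * fourier (-m + -q) x := by
    intro x
    rw [wave_coe, fourier_add, fourier_add]; ring
  simp only [h]
  rw [integral_add (integrable_of_continuous (by fun_prop)) (integrable_of_continuous (by fun_prop)),
    integral_const_mul, integral_const_mul, integral_fourier, integral_fourier]
  by_cases h1 : m = q
  · subst h1
    have : ¬ (-m + -m = 0) := by omega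
    simp [this]
  · have h2 : ¬ (-m + q = 0) := by omega
    by_cases h3 : m = -q
    · subst h3
      have : ¬ (-q = q) := by omega
      have h4 : ¬ (q + q = 0) := by omega
      simp [this, h4]
    · have : ¬ (-m + -q = 0) := by omega
      simp [h1, h2, h3, this]

lemma integral_wave (w : ℂ) {q : ℤ} (hq : q ≠ 0) : ∫ x, wave w q x = 0 := by
  have h := fourierCoeff_wave w hq 0
  rw [coeff, fourierCoeff_eq, if_neg hq.symm, if_neg (by omega)] at h
  simp only [neg_zero, fourier_zero, one_mul] at h
  rw [integral_complex_ofReal] at h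
  exact_mod_cast h

lemma integral_wave_sq (w : ℂ) {q : ℤ} (hq : q ≠ 0) : ∫ x, wave w q x ^ 2 = 2 * ‖w‖ ^ 2 := by
  have h : ∀ x : UnitAddCircle, wave w q x ^ 2 = 2 * ‖w‖ ^ 2 + wave (w ^ 2) (q + q) x := by
    intro x
    have h1 : Complex.normSq (w * fourier q x) = ‖w‖ ^ 2 := by
      rw [Complex.normSq_eq_norm_sq, norm_mul, norm_fourier_apply, mul_one]
    have h2 : w ^ 2 * fourier (q + q) x = (w * fourier q x) ^ 2 := by
      rw [fourier_add]; ring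
    rw [wave, wave, h2, ← h1]
    generalize w * fourier q x = z
    rw [Complex.normSq_apply, pow_two z, Complex.mul_re]
    ring
  simp only [h]
  rw [integral_add (integrable_const _) (integrable_of_continuous (continuous_wave _ _)),
    integral_wave _ (by omega)]
  simp

lemma norm_expInt_wave_le {ν : ℝ} {w : ℂ} {q : ℤ} (hq : q ≠ 0)
    (h : 2 * Real.pi * |ν| * ‖w‖ ≤ 1 / 4) :
    ‖expInt ν (wave w q)‖ ≤ 1 - (2 * Real.pi * |ν| * ‖w‖) ^ 2 / 2 := by
  set β : ℝ := 2 * Real.pi * ν with hβ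
  have hβ' : |β| = 2 * Real.pi * |ν| := by rw [hβ, abs_mul, abs_of_pos Real.two_pi_pos]
  rw [← hβ'] at h ⊢
  set r := |β| * ‖w‖ with hr
  have hr0 : 0 ≤ r := by positivity
  have hexp : ∀ x, Complex.exp (2 * Real.pi * Complex.I * ν * wave w q x)
      = Complex.exp ((β * wave w q x : ℝ) * Complex.I) := by
    intro x; congr 1; rw [hβ]; push_cast; ring
  set T : UnitAddCircle → ℂ := fun x =>
    1 + β * Complex.I * wave w q x - ((β ^ 2 / 2 : ℝ) : ℂ) * ((wave w q x ^ 2 : ℝ) : ℂ) with hT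
  have hTc : Continuous T := by
    have := continuous_wave w q
    fun_prop
  have hTint : ∫ x, T x = ((1 - r ^ 2 : ℝ) : ℂ) := by
    have hc := continuous_wave w q
    rw [hT, integral_sub (integrable_of_continuous (by fun_prop))
      (integrable_of_continuous (by fun_prop)),
      integral_add (integrable_const _) (integrable_of_continuous (by fun_prop)),
      integral_const_mul, integral_const_mul, integral_complex_ofReal, integral_complex_ofReal,
      integral_wave _ hq, integral_wave_sq _ hq]
    simp only [integral_const, probReal_univ, one_smul]
    have hr2 : r ^ 2 = β ^ 2 * ‖w‖ ^ 2 := by rw [hr, mul_pow |β|, sq_abs]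
    rw [hr2]
    push_cast
    ring
  have hbound : ∀ x, ‖Complex.exp (2 * Real.pi * Complex.I * ν * wave w q x) - T x‖
      ≤ r ^ 2 / 2 := by
    intro x
    rw [hexp]
    set y : ℂ := (β * wave w q x : ℝ) * Complex.I with hy
    have hyn : ‖y‖ ≤ 2 * r := by
      rw [hy, norm_mul, Complex.norm_I, mul_one, Complex.norm_real, Real.norm_eq_abs, abs_mul]
      have := mul_le_mul_of_nonneg_left (abs_wave_le w q x) (abs_nonneg β)
      linarith
    have hb := Complex.exp_bound (x := y) (by linarith) (n := 3) (by norm_num)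
    have hsum : ∑ m ∈ Finset.range 3, y ^ m / (m.factorial : ℂ) = T x := by
      simp only [Finset.sum_range_succ, Finset.sum_range_zero, hT, hy]
      norm_num [Nat.factorial]
      rw [mul_pow, Complex.I_sq]
      ring
    rw [hsum] at hb
    refine hb.trans ?_
    have h3 : ‖y‖ ^ 3 ≤ (2 * r) ^ 3 := by gcongr
    norm_num [Nat.factorial]
    nlinarith [mul_nonneg hr0 hr0]
  have hkey : expInt ν (wave w q) = (∫ x, T x)
      + ∫ x, (Complex.exp (2 * Real.pi * Complex.I * ν * wave w q x) - T x) := by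
    rw [integral_sub (integrable_of_continuous (continuous_exp_comp (continuous_wave w q) ν))
      (integrable_of_continuous hTc), expInt]
    ring
  rw [hkey, hTint]
  refine (norm_add_le _ _).trans ?_
  have h1 : ‖((1 - r ^ 2 : ℝ) : ℂ)‖ = 1 - r ^ 2 := by
    rw [Complex.norm_real, Real.norm_eq_abs, abs_of_nonneg]
    nlinarith
  have h2 := norm_integral_le_of_norm_le_const (μ := (volume : Measure UnitAddCircle))
    (Eventually.of_forall hbound)
  simp only [probReal_univ, mul_one] at h2
  rw [h1]
  linarith

/-! ### Near independence of slow and fast oscillations -/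

lemma exists_norm_sub_nsmul_le {q : ℕ} (hq : 0 < q) (x : UnitAddCircle) :
    ∃ k : ℕ, ‖x - k • (((1 / q : ℝ)) : UnitAddCircle)‖ ≤ 1 / q := by
  have hq0 : (0 : ℝ) < q := by exact_mod_cast hq
  obtain ⟨t, ht, hx⟩ : ∃ t : ℝ, 0 ≤ t ∧ (t : UnitAddCircle) = x := by
    obtain ⟨t, ht, h2⟩ := AddCircle.coe_image_Ico_eq (1 : ℝ) 0 ▸ Set.mem_univ x
    exact ⟨t, ht.1, h2⟩
  refine ⟨⌊q * t⌋₊, ?_⟩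
  rw [← hx, ← AddCircle.coe_nsmul, ← AddCircle.coe_sub]
  refine (norm_coe_le_abs _).trans ?_
  have h1 := Nat.floor_le (a := q * t) (by positivity)
  have h2 := Nat.lt_floor_add_one (q * t)
  have e : t - ⌊q * t⌋₊ • (1 / (q : ℝ)) = (q * t - ⌊q * t⌋₊) / q := by
    rw [nsmul_eq_mul]; field_simp
  rw [e, abs_of_nonneg (by apply div_nonneg <;> linarith)]
  gcongr
  linarith

lemma norm_integral_mul_sub_le {f g : UnitAddCircle → ℂ} (hf : Continuous f) (hg : Continuous g)
    {L : ℝ} (hL : ∀ x y, ‖f x - f y‖ ≤ L * ‖x - y‖) (hg1 : ∀ x, ‖g x‖ ≤ 1)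
    {q : ℕ} (hq : 0 < q) (hper : ∀ x, g (x + ((1 / q : ℝ) : UnitAddCircle)) = g x) :
    ‖(∫ x, f x * g x) - (∫ x, f x) * ∫ x, g x‖ ≤ L / q := by
  have hq0 : (0 : ℝ) < q := by exact_mod_cast hq
  set b : UnitAddCircle := ((1 / q : ℝ) : UnitAddCircle) with hb
  have hqb : q • b = 0 := by
    rw [hb, ← AddCircle.coe_nsmul, nsmul_eq_mul, mul_one_div_cancel hq0.ne']
    exact AddCircle.coe_period 1
  have hL0 : 0 ≤ L := by
    by_contra! hneg
    have h1 := hL ((1 / 2 : ℝ) : UnitAddCircle) 0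
    rw [sub_zero, norm_coe_eq_abs (by norm_num)] at h1
    have := norm_nonneg (f ((1 / 2 : ℝ) : UnitAddCircle) - f 0)
    rw [abs_of_pos (by norm_num)] at h1
    linarith
  have hperk : ∀ (k : ℕ) x, g (x + k • b) = g x := by
    intro k
    induction k with
    | zero => simp
    | succ k ih => intro x; rw [succ_nsmul, ← add_assoc, hper, ih]
  set M : UnitAddCircle → ℂ := fun x => (q : ℂ)⁻¹ * ∑ k ∈ Finset.range q, f (x + k • b) with hM
  have hMc : Continuous M := by fun_prop
  have hMper : ∀ x, M (x + b) = M x := by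
    intro x
    simp only [hM]
    congr 1
    have h1 := Finset.sum_range_succ' (fun k => f (x + k • b)) q
    rw [Finset.sum_range_succ, hqb, zero_smul] at h1
    rw [add_right_cancel h1]
    refine Finset.sum_congr rfl fun k _ => ?_
    rw [succ_nsmul, add_assoc, add_comm b]
  have hMperk : ∀ (k : ℕ) x, M (x + k • b) = M x := by
    intro k
    induction k with
    | zero => simp
    | succ k ih => intro x; rw [succ_nsmul, ← add_assoc, hMper, ih]
  have hMlip : ∀ x y, ‖M x - M y‖ ≤ L * ‖x - y‖ := by
    intro x y
    simp only [hM]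
    rw [← mul_sub, ← Finset.sum_sub_distrib, norm_mul, norm_inv, Complex.norm_natCast]
    have : ‖∑ k ∈ Finset.range q, (f (x + k • b) - f (y + k • b))‖ ≤ q * (L * ‖x - y‖) := by
      refine (norm_sum_le _ _).trans ?_
      have := Finset.sum_le_sum (s := Finset.range q)
        (f := fun k => ‖f (x + k • b) - f (y + k • b)‖) (g := fun _ => L * ‖x - y‖)
        (fun k _ => by simpa using hL (x + k • b) (y + k • b))
      simpa using this
    rw [inv_mul_le_iff₀ hq0]
    exact this
  have hMosc : ∀ x y, ‖M x - M y‖ ≤ L / q := by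
    intro x y
    obtain ⟨k, hk⟩ := exists_norm_sub_nsmul_le hq (x - y)
    have h1 := hMlip x (y + k • b)
    rw [hMperk] at h1
    refine h1.trans ?_
    rw [div_eq_mul_one_div]
    gcongr
    rwa [← sub_sub]
  have hMint : ∫ x, M x = ∫ x, f x := by
    simp only [hM]
    rw [integral_const_mul, integral_finsetSum _
      (fun k _ => integrable_of_continuous (by fun_prop))]
    simp only [integral_add_right_eq_self, Finset.sum_const, Finset.card_range, nsmul_eq_mul]
    rw [← mul_assoc, inv_mul_cancel₀ (by exact_mod_cast hq.ne'), one_mul]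
  have hMg : ∫ x, M x * g x = ∫ x, f x * g x := by
    have h1 : ∀ x, M x * g x
        = (q : ℂ)⁻¹ * ∑ k ∈ Finset.range q, f (x + k • b) * g (x + k • b) := by
      intro x
      simp only [hM, hperk]
      rw [← Finset.sum_mul]; ring
    simp only [h1]
    rw [integral_const_mul, integral_finsetSum _
      (fun k _ => integrable_of_continuous (by fun_prop))]
    have h2 : ∀ k : ℕ, ∫ x, f (x + k • b) * g (x + k • b) = ∫ x, f x * g x := fun k =>
      integral_add_right_eq_self (fun x => f x * g x) (k • b)
    simp only [h2, Finset.sum_const, Finset.card_range, nsmul_eq_mul]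
    rw [← mul_assoc, inv_mul_cancel₀ (by exact_mod_cast hq.ne'), one_mul]
  have hdev : ∀ x, ‖M x - ∫ y, f y‖ ≤ L / q := by
    intro x
    have h1 : M x - ∫ y, f y = ∫ y, (M x - M y) := by
      rw [integral_sub (integrable_const _) (integrable_of_continuous hMc), hMint]
      simp
    rw [h1]
    have := norm_integral_le_of_norm_le_const (μ := (volume : Measure UnitAddCircle))
      (Eventually.of_forall (hMosc x))
    simpa using this
  have hfin : (∫ x, f x * g x) - (∫ x, f x) * ∫ x, g x = ∫ x, (M x - ∫ y, f y) * g x := by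
    rw [← hMg, ← integral_const_mul, ← integral_sub (integrable_of_continuous (by fun_prop))
      (integrable_of_continuous (by fun_prop))]
    congr 1
    ext x
    ring
  rw [hfin]
  have := norm_integral_le_of_norm_le_const (μ := (volume : Measure UnitAddCircle)) (C := L / q)
      (f := fun x => (M x - ∫ y, f y) * g x)
      (Eventually.of_forall fun x => by
        rw [norm_mul]
        calc _ ≤ L / q * 1 := by gcongr; exacts [hdev x, hg1 x]
          _ = L / q := mul_one _)
  simpa using this

lemma fourier_inv_eq_one {q : ℕ} (hq : 0 < q) :
    (fourier (q : ℤ) ((1 / q : ℝ) : UnitAddCircle) : ℂ) = 1 := by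
  have hq0 : (q : ℂ) ≠ 0 := by exact_mod_cast hq.ne'
  rw [fourier_coe_apply]
  have : 2 * (Real.pi : ℂ) * Complex.I * ((q : ℤ) : ℂ) * ((1 / q : ℝ) : ℂ) / (1 : ℝ)
      = 2 * Real.pi * Complex.I := by
    push_cast
    field_simp
  rw [this, Complex.exp_two_pi_mul_I]

/-- The integral of `e^{2 π i ν Y}` for a sparse trigonometric polynomial `Y` is almost the product
of the corresponding integrals of its monomials. -/
lemma norm_expInt_sum_wave_le {α ν : ℝ} (w : ℕ → ℂ) (F : Finset ℕ)
    (hF : ∀ q ∈ F, IsGoodDenom α q ∧ 32 ≤ q ∧ 2 * Real.pi * |ν| * ‖w q‖ ≤ 1 / 4) :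
    ‖expInt ν (fun x => ∑ q ∈ F, wave (w q) q x)‖
      ≤ Real.exp (-∑ q ∈ F, (2 * Real.pi * |ν| * ‖w q‖) ^ 2 / 2) + 12 * ∑ q ∈ F, 1 / √(q : ℝ) := by
  induction F using Finset.induction_on_max with
  | empty => simp [expInt]
  | insert q s hs ih =>
    obtain ⟨hq, hq32, hw⟩ := hF q (Finset.mem_insert_self _ _)
    have hqs : q ∉ s := fun h => (hs q h).false
    have hF' : ∀ p ∈ s, IsGoodDenom α p ∧ 32 ≤ p ∧ 2 * Real.pi * |ν| * ‖w p‖ ≤ 1 / 4 := fun p hp =>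
      hF p (Finset.mem_insert_of_mem hp)
    have hs' := ih hF'
    have hq0 : (0 : ℝ) < q := by exact_mod_cast hq.pos
    set Y : UnitAddCircle → ℝ := fun x => ∑ p ∈ s, wave (w p) p x with hY
    have hYc : Continuous Y := continuous_finsetSum _ fun p _ => continuous_wave _ _
    set f : UnitAddCircle → ℂ := fun x => Complex.exp (2 * Real.pi * Complex.I * ν * Y x)
    set g : UnitAddCircle → ℂ := fun x => Complex.exp (2 * Real.pi * Complex.I * ν * wave (w q) q x)
    have hfg : expInt ν (fun x => ∑ p ∈ insert q s, wave (w p) p x) = ∫ x, f x * g x := by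
      rw [expInt]
      congr 1
      ext x
      rw [Finset.sum_insert hqs, ← Complex.exp_add]
      push_cast
      simp only [hY]
      push_cast
      ring_nf
    have hlip : ∀ x y, ‖f x - f y‖ ≤ (12 * √q) * ‖x - y‖ := by
      intro x y
      refine (norm_exp_sub_exp_le ν _ _).trans ?_
      have h1 : |Y x - Y y| ≤ ∑ p ∈ s, 16 * ‖w p‖ * p * ‖x - y‖ := by
        rw [hY, ← Finset.sum_sub_distrib]
        exact (Finset.abs_sum_le_sum_abs _ _).trans
          (Finset.sum_le_sum fun p _ => abs_wave_sub_le _ _ _ _)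
      have h2 : 2 * Real.pi * |ν| * (∑ p ∈ s, 16 * ‖w p‖ * p * ‖x - y‖)
          ≤ ∑ p ∈ s, 4 * (p : ℝ) * ‖x - y‖ := by
        rw [Finset.mul_sum]
        refine Finset.sum_le_sum fun p hp => ?_
        have h3 := (hF' p hp).2.2
        calc 2 * Real.pi * |ν| * (16 * ‖w p‖ * p * ‖x - y‖)
            = (2 * Real.pi * |ν| * ‖w p‖) * (16 * (p * ‖x - y‖)) := by ring
          _ ≤ 1 / 4 * (16 * (p * ‖x - y‖)) := by gcongr
          _ = _ := by ring
      have h4 := sum_sq_le_of_goodDenom s q hq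
        (fun p hp => ⟨(hF' p hp).1, (hF' p hp).2.1, hs p hp⟩)
      calc 2 * Real.pi * |ν| * |Y x - Y y|
          ≤ 2 * Real.pi * |ν| * (∑ p ∈ s, 16 * ‖w p‖ * p * ‖x - y‖) := by
            have := Real.pi_pos
            gcongr
        _ ≤ ∑ p ∈ s, 4 * (p : ℝ) * ‖x - y‖ := h2
        _ = 4 * (∑ p ∈ s, (p : ℝ)) * ‖x - y‖ := by rw [← Finset.sum_mul, Finset.mul_sum]
        _ ≤ 4 * (3 * √q) * ‖x - y‖ := by gcongr
        _ = _ := by ring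
    have hind := norm_integral_mul_sub_le (continuous_exp_comp hYc ν)
      (continuous_exp_comp (continuous_wave (w q) q) ν) hlip
      (fun x => (norm_exp_eq_one ν _).le) hq.pos (fun x => by
        rw [wave_add, fourier_inv_eq_one hq.pos, mul_one])
    have hgb := norm_expInt_wave_le (ν := ν) (w := w q) (q := q) (by exact_mod_cast hq.pos.ne') hw
    have hg1 : ‖expInt ν (wave (w q) q)‖ ≤ Real.exp (-((2 * Real.pi * |ν| * ‖w q‖) ^ 2 / 2)) := by
      refine hgb.trans ?_
      have := Real.add_one_le_exp (-((2 * Real.pi * |ν| * ‖w q‖) ^ 2 / 2))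
      linarith
    have hexp1 : Real.exp (-((2 * Real.pi * |ν| * ‖w q‖) ^ 2 / 2)) ≤ 1 := by
      rw [Real.exp_le_one_iff]; simp; positivity
    rw [hfg, Finset.sum_insert hqs, Finset.sum_insert hqs, neg_add, Real.exp_add]
    have hsq : (12 * √(q : ℝ)) / q = 12 * (1 / √q) := by
      rw [mul_div_assoc, Real.sqrt_div_self', ]
    rw [hsq] at hind
    have hprod : ‖(∫ x, f x) * ∫ x, g x‖ ≤ Real.exp (-((2 * Real.pi * |ν| * ‖w q‖) ^ 2 / 2)) *
        Real.exp (-∑ q ∈ s, (2 * Real.pi * |ν| * ‖w q‖) ^ 2 / 2) + 12 * ∑ q ∈ s, 1 / √(q : ℝ) := by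
      rw [norm_mul]
      have hs0 : 0 ≤ ∑ q ∈ s, 1 / √(q : ℝ) := by positivity
      calc ‖∫ x, f x‖ * ‖∫ x, g x‖
          ≤ (Real.exp (-∑ q ∈ s, (2 * Real.pi * |ν| * ‖w q‖) ^ 2 / 2) + 12 * ∑ q ∈ s, 1 / √(q : ℝ))
            * Real.exp (-((2 * Real.pi * |ν| * ‖w q‖) ^ 2 / 2)) := by
            gcongr
            · exact hs'
            · exact hg1
        _ ≤ _ := by
          rw [add_mul, mul_comm (Real.exp _)]
          exact add_le_add_right (mul_le_of_le_one_right (by positivity) hexp1) _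
    have := norm_sub_norm_le (∫ x, f x * g x) ((∫ x, f x) * ∫ x, g x)
    rw [mul_add]
    linarith

/-! ### Birkhoff sums and multiplicative coboundaries -/

/-- The Birkhoff sum `F x + F (x + a) + ⋯ + F (x + (N - 1) a)`. -/
def bsum (a : UnitAddCircle) (F : UnitAddCircle → ℝ) (N : ℕ) (x : UnitAddCircle) : ℝ :=
  ∑ k ∈ Finset.range N, F (x + k • a)

lemma continuous_bsum (a : UnitAddCircle) {F : UnitAddCircle → ℝ} (hF : Continuous F) (N : ℕ) :
    Continuous (bsum a F N) := by
  unfold bsum; fun_prop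

lemma bsum_add (a : UnitAddCircle) (F : UnitAddCircle → ℝ) (N M : ℕ) (x : UnitAddCircle) :
    bsum a F (N + M) x = bsum a F N x + bsum a F M (x + N • a) := by
  simp only [bsum, Finset.sum_range_add, add_smul, add_assoc]

lemma bsum_wave (a : UnitAddCircle) (w : ℂ) (q : ℤ) (N : ℕ) (x : UnitAddCircle) :
    bsum a (wave w q) N x = wave (w * geomChar a N q) q x := by
  simp only [bsum, wave_add]
  simp only [geomChar, Finset.mul_sum, wave, Finset.sum_mul, Complex.re_sum]

lemma coeff_bsum (a : UnitAddCircle) {F : UnitAddCircle → ℝ} (hF : Continuous F) (N : ℕ) (m : ℤ) :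
    coeff (bsum a F N) m = geomChar a N m * coeff F m := by
  have h : (fun x => (bsum a F N x : ℂ)) = fun x => ∑ k ∈ Finset.range N, (F (x + k • a) : ℂ) := by
    ext x; simp [bsum]
  rw [coeff, h, fourierCoeff_sum' _ (fun k _ => integrable_of_continuous (by fun_prop)), geomChar,
    Finset.sum_mul]
  refine Finset.sum_congr rfl fun k _ => ?_
  exact fourierCoeff_translate (fun x => (F x : ℂ)) (k • a) m

lemma ae_iterate_cocycle {a : UnitAddCircle} {ν : ℝ} {F : UnitAddCircle → ℝ}
    {G : UnitAddCircle → ℂ}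
    (hG : ∀ᵐ x, G (x + a) = Complex.exp (2 * Real.pi * Complex.I * ν * F x) * G x) (N : ℕ) :
    ∀ᵐ x, G (x + N • a) = Complex.exp (2 * Real.pi * Complex.I * ν * bsum a F N x) * G x := by
  induction N with
  | zero => simp [bsum]
  | succ N ih =>
    filter_upwards [ih, (measurePreserving_rotation (N • a)).quasiMeasurePreserving.ae hG]
      with x h1 h2
    rw [succ_nsmul, ← add_assoc, h2, h1, ← mul_assoc, ← Complex.exp_add]
    congr 2
    simp only [bsum, Finset.sum_range_succ]
    push_cast
    ring

/-- The Birkhoff sums of a multiplicative coboundary are nearly trivial at rigidity times. -/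
lemma exists_forall_expInt_near_one {a : UnitAddCircle} {ν : ℝ} {F : UnitAddCircle → ℝ}
    {G : UnitAddCircle → ℂ} (hGm : Measurable G) (hG1 : ∀ᵐ x, ‖G x‖ = 1)
    (hG : ∀ᵐ x, G (x + a) = Complex.exp (2 * Real.pi * Complex.I * ν * F x) * G x)
    {ε : ℝ} (hε : 0 < ε) :
    ∃ δ > 0, ∀ N : ℕ, ‖N • a‖ < δ → 1 - ε < ‖expInt ν (bsum a F N)‖ := by
  have h := tendsto_integral_translate_mul_conj hGm hG1
  rw [Metric.tendsto_nhds_nhds] at h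
  obtain ⟨δ, hδ, h⟩ := h ε hε
  refine ⟨δ, hδ, fun N hN => ?_⟩
  have h2 := h (x := N • a) (by simpa using hN)
  have e : expInt ν (bsum a F N) = ∫ x, G (x + N • a) * (starRingEnd ℂ) (G x) := by
    refine integral_congr_ae ?_
    filter_upwards [ae_iterate_cocycle hG N, hG1] with x hx h1
    rw [hx, mul_assoc _ (G x), Complex.mul_conj, Complex.normSq_eq_norm_sq, h1]
    simp
  rw [← e, dist_eq_norm] at h2
  have := norm_sub_norm_le (1 : ℂ) (expInt ν (bsum a F N))
  rw [norm_one, norm_sub_rev] at this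
  linarith

/-! ### A single scale -/

lemma integral_sq_eq_two_mul_tsum {f : UnitAddCircle → ℝ} (hf : MemLp f 2 volume)
    (h0 : coeff f 0 = 0) :
    HasSum (fun n : ℕ => 2 * ‖coeff f n‖ ^ 2) (∫ x, f x ^ 2) := by
  have h := (hasSum_sq_norm_fourierCoeff (memLp_two_ofReal hf)).nat_add_neg
  have h0' : fourierCoeff (fun x => (f x : ℂ)) 0 = 0 := h0
  simp only [h0', norm_zero, Complex.norm_real, Real.norm_eq_abs, sq_abs] at h
  simp only [ne_eq, OfNat.ofNat_ne_zero, not_false_eq_true, zero_pow, add_zero] at h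
  convert h using 2 with n
  have := norm_coeff_neg f n
  simp only [coeff] at this ⊢
  rw [this]; ring

lemma summable_nat_mul_coeff_sq {c : ℤ → ℂ} {C : ℝ} (hC : ∀ m : ℤ, ‖c m‖ * |(m : ℝ)| ^ 3 ≤ C) :
    Summable fun n : ℕ => (2 * (n : ℝ) * ‖c n‖) ^ 2 := by
  have hC0 : 0 ≤ C := by simpa using hC 0
  refine Summable.of_nonneg_of_le (fun _ => by positivity) (fun n => ?_)
    ((Real.summable_one_div_nat_pow.2 (by norm_num : 1 < 2)).mul_left ((2 * C) ^ 2))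
  rcases Nat.eq_zero_or_pos n with rfl | hn
  · simp
  have hn1 : (1 : ℝ) ≤ n := by exact_mod_cast hn
  have h := hC n
  rw [Int.cast_natCast, Nat.abs_cast] at h
  rw [mul_one_div, ← div_pow]
  gcongr
  rw [le_div_iff₀ (by linarith)]
  calc 2 * (n : ℝ) * ‖c n‖ * n = 2 * (‖c n‖ * n ^ 2) := by ring
    _ ≤ 2 * (‖c n‖ * n ^ 3) := by gcongr; norm_num
    _ ≤ 2 * C := by linarith

lemma coeff_sub {f g : UnitAddCircle → ℝ} (hf : Continuous f) (hg : Continuous g) (m : ℤ) :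
    coeff (fun x => f x - g x) m = coeff f m - coeff g m := by
  have := fourierCoeff_sub' (f := fun x => (f x : ℂ)) (g := fun x => (g x : ℂ))
    (integrable_of_continuous (by fun_prop)) (integrable_of_continuous (by fun_prop)) m
  simp only [coeff]
  rw [← this]
  congr 1
  ext x
  push_cast
  rfl

lemma coeff_const (c : ℝ) (m : ℤ) : coeff (fun _ => c) m = if m = 0 then (c : ℂ) else 0 :=
  fourierCoeff_const' (c : ℂ) m

lemma norm_geomChar_le_two_mul {α : ℝ} {q N m : ℕ} (hq : IsGoodDenom α q)
    (hN : N * ‖q • (α : UnitAddCircle)‖ ≤ 1 / 2) (hN2 : ‖N • (α : UnitAddCircle)‖ ≤ 1 / (2 * q))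
    (hα : Irrational α) (hm : ¬ q ∣ m) : ‖geomChar (α : UnitAddCircle) N m‖ ≤ 2 * m := by
  have hq0 : (0 : ℝ) < q := by exact_mod_cast hq.pos
  by_cases h : m * ‖q • (α : UnitAddCircle)‖ ≤ 1 / 2
  · have h1 := hq.norm_ge hm h
    have h2 := norm_geomChar_mul_le (α : UnitAddCircle) N m
    rw [natCast_zsmul, Int.cast_natCast, Nat.abs_cast] at h2
    have hpos : (0 : ℝ) < 1 / (2 * q) := by positivity
    have h3 : ‖geomChar (α : UnitAddCircle) N m‖ * (1 / (2 * q)) ≤ 2 * m * (1 / (2 * q)) :=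
      calc _ ≤ ‖geomChar (α : UnitAddCircle) N m‖ * ‖m • (α : UnitAddCircle)‖ := by gcongr
        _ ≤ _ := h2
        _ ≤ _ := by gcongr
    exact le_of_mul_le_mul_right h3 hpos
  · push Not at h
    have h1 := norm_geomChar_le (α : UnitAddCircle) N m
    have hpos := norm_nsmul_pos hα hq.pos.ne'
    have h2 : (N : ℝ) ≤ m := le_of_mul_le_mul_right (hN.trans h.le) hpos
    have : (0 : ℝ) ≤ m := by positivity
    linarith

lemma tsum_multiples_le {c : ℤ → ℂ} {q : ℕ} (hq : 0 < q) {B : ℝ} {N : ℝ}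
    (hB : ∑' l : ℕ, ‖c ((l + 2) * q)‖ ^ 2 ≤ B)  :
    ∑' n : ℕ, (if q ∣ n ∧ n ≠ 0 ∧ n ≠ q then N ^ 2 * ‖c n‖ ^ 2 else 0) ≤ N ^ 2 * B := by
  have hinj : Function.Injective fun l : ℕ => (l + 2) * q := fun a b h => by
    have := Nat.eq_of_mul_eq_mul_right hq h
    omega
  rw [← hinj.tsum_eq]
  · have h : ∀ l : ℕ, (if q ∣ (l + 2) * q ∧ (l + 2) * q ≠ 0 ∧ (l + 2) * q ≠ q then
        N ^ 2 * ‖c ((l + 2) * q : ℕ)‖ ^ 2 else 0) = N ^ 2 * ‖c ((l + 2) * q)‖ ^ 2 := by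
      intro l
      rw [if_pos]
      · push_cast; rfl
      · refine ⟨dvd_mul_left _ _, by positivity, fun h => ?_⟩
        nlinarith
    simp only [h]
    rw [tsum_mul_left]
    gcongr
  · intro n hn
    simp only [Function.mem_support, ne_eq, ite_eq_right_iff, Classical.not_imp] at hn
    obtain ⟨⟨⟨l, rfl⟩, h0, h1⟩, -⟩ := hn
    have hl0 : l ≠ 0 := by rintro rfl; simp at h0
    have hl1 : l ≠ 1 := by rintro rfl; simp at h1
    exact ⟨l - 2, by simp only []; rw [Nat.sub_add_cancel (by omega), mul_comm]⟩

/-- The ratio `|c_q| / ‖q α‖` tends to zero along good denominators when `e^{2 π i ν φ}` is a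
multiplicative coboundary. -/
lemma eventually_coeff_lt {α : ℝ} (hα : Irrational α) {φ : UnitAddCircle → ℝ} (hφ : Continuous φ)
    {C : ℝ} (hC : ∀ m : ℤ, ‖coeff φ m‖ * |(m : ℝ)| ^ 3 ≤ C) (h1 : H1 φ) {ν : ℝ} (hν : ν ≠ 0)
    (hK : ∀ ε > 0, ∃ δ > 0, ∀ N : ℕ, ‖N • (α : UnitAddCircle)‖ < δ →
      1 - ε < ‖expInt ν (bsum (α : UnitAddCircle) φ N)‖) {ε : ℝ} (hε : 0 < ε) :
    ∀ᶠ q : ℕ in atTop, IsGoodDenom α q → ‖coeff φ q‖ < ε * ‖q • (α : UnitAddCircle)‖ := by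
  set a : UnitAddCircle := (α : UnitAddCircle) with ha
  by_contra hcon
  rw [not_eventually] at hcon
  set S : Set ℕ := {q | ¬ (IsGoodDenom α q → ‖coeff φ q‖ < ε * ‖q • a‖)} with hS
  have hne : (atTop ⊓ 𝓟 S).NeBot := frequently_mem_iff_neBot.1 hcon
  set 𝓕 := (atTop : Filter ℕ) ⊓ 𝓟 S with h𝓕
  have hle : 𝓕 ≤ atTop := inf_le_left
  have hC0 : 0 ≤ C := by simpa using hC 0
  have hν0 : 0 < |ν| := abs_pos.2 hν
  have hpi := Real.pi_pos
  obtain ⟨δ, hδ0, hδε, hδν⟩ : ∃ δ > 0, δ ≤ ε / 2 ∧ 2 * Real.pi * |ν| * δ ≤ 1 / 4 := by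
    refine ⟨min (ε / 2) (1 / (8 * Real.pi * |ν|)), by positivity, min_le_left _ _, ?_⟩
    calc 2 * Real.pi * |ν| * min (ε / 2) (1 / (8 * Real.pi * |ν|))
        ≤ 2 * Real.pi * |ν| * (1 / (8 * Real.pi * |ν|)) := by gcongr; exact min_le_right _ _
      _ = 1 / 4 := by field_simp; norm_num
  set k : ℕ → ℕ := fun q => ⌊δ / (q * ‖coeff φ q‖)⌋₊ with hk
  set N : ℕ → ℕ := fun q => k q * q with hN
  have hqS : ∀ᶠ q in 𝓕, IsGoodDenom α q ∧ ε * ‖q • a‖ ≤ ‖coeff φ q‖ := by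
    filter_upwards [mem_inf_of_right (mem_principal_self S)] with q hq
    simpa [hS] using hq
  -- basic size estimates
  have hbig : ∀ᶠ q : ℕ in 𝓕, q * ‖coeff φ q‖ ≤ δ / 2 := by
    have : Tendsto (fun q : ℕ => C / (q : ℝ)) atTop (nhds 0) := tendsto_const_div_atTop_nhds_zero_nat C
    filter_upwards [hle ((this.eventually_le_const (half_pos hδ0)).and (eventually_ge_atTop 1))]
      with q hq
    refine le_trans ?_ hq.1
    have hq1 : (1 : ℝ) ≤ q := by exact_mod_cast hq.2
    rw [le_div_iff₀ (by linarith)]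
    have := hC q
    rw [Int.cast_natCast, Nat.abs_cast] at this
    calc (q : ℝ) * ‖coeff φ q‖ * q = ‖coeff φ q‖ * q ^ 2 := by ring
      _ ≤ ‖coeff φ q‖ * q ^ 3 := by gcongr; norm_num
      _ ≤ C := this
  have hest : ∀ᶠ q : ℕ in 𝓕, IsGoodDenom α q ∧ N q * ‖coeff φ q‖ ≤ δ ∧ δ / 2 ≤ N q * ‖coeff φ q‖ ∧
      N q * ‖q • a‖ ≤ 1 / 2 ∧ ‖N q • a‖ ≤ 1 / (2 * q) := by
    filter_upwards [hqS, hbig] with q ⟨hq, hqc⟩ hb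
    have hpos : 0 < ‖q • a‖ := norm_nsmul_pos hα hq.pos.ne'
    have hc0 : 0 < ‖coeff φ q‖ := lt_of_lt_of_le (by positivity) hqc
    have hq0 : (0 : ℝ) < q := by exact_mod_cast hq.pos
    have f1 := Nat.floor_le (a := δ / (q * ‖coeff φ q‖)) (by positivity)
    have f2 := Nat.lt_floor_add_one (δ / (q * ‖coeff φ q‖))
    rw [le_div_iff₀ (by positivity)] at f1
    rw [div_lt_iff₀ (by positivity)] at f2
    have e1 : (N q : ℝ) = k q * q := by simp [hN]
    have g1 : N q * ‖coeff φ q‖ ≤ δ := by rw [e1]; linarith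
    have g2 : N q * ‖q • a‖ ≤ 1 / 2 := by
      have : ε * (N q * ‖q • a‖) ≤ ε * (1 / 2) := by
        calc ε * (N q * ‖q • a‖) = N q * (ε * ‖q • a‖) := by ring
          _ ≤ N q * ‖coeff φ q‖ := by gcongr
          _ ≤ _ := by linarith
      exact le_of_mul_le_mul_left this hε
    refine ⟨hq, g1, ?_, g2, ?_⟩
    · rw [e1]; linarith
    · have : ‖N q • a‖ ≤ k q * ‖q • a‖ := by
        simp only [hN]
        rw [mul_smul]
        simpa using norm_nsmul_le (n := k q) (a := q • a)
      refine this.trans ?_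
      rw [le_div_iff₀ (by positivity)]
      rw [e1] at g2
      linarith
  -- the remainder
  set R : ℕ → UnitAddCircle → ℝ := fun q x => bsum a φ (N q) x - (N q * (coeff φ 0).re)
    - wave (geomChar a (N q) q * coeff φ q) q x with hR
  have hc0re : ((coeff φ 0).re : ℂ) = coeff φ 0 := by
    have := fourierCoeff_conj φ 0
    rw [neg_zero] at this
    exact Complex.conj_eq_iff_re.1 this.symm
  have hRcont : ∀ q, Continuous (R q) := fun q =>
    ((continuous_bsum a hφ _).sub continuous_const).sub (continuous_wave _ _)
  have hRcoeff : ∀ q : ℕ, 0 < q → ∀ n : ℕ, coeff (R q) n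
      = if n = 0 ∨ n = q then 0 else geomChar a (N q) n * coeff φ n := by
    intro q hq n
    have hq' : (q : ℤ) ≠ 0 := by exact_mod_cast hq.ne'
    rw [hR]
    simp only
    rw [coeff_sub (f := fun x => bsum a φ (N q) x - N q * (coeff φ 0).re)
        ((continuous_bsum a hφ _).sub continuous_const) (continuous_wave _ _),
      coeff_sub (continuous_bsum a hφ _) continuous_const, coeff_bsum a hφ, coeff_const,
      fourierCoeff_wave _ hq']
    by_cases hn0 : n = 0
    · subst hn0
      have e1 : ¬ ((0 : ℕ) : ℤ) = q := by omega
      have e2 : ¬ ((0 : ℕ) : ℤ) = -q := by omega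
      rw [if_neg e1, if_neg e2]
      simp [geomChar, hc0re]
    · have e0 : ¬ (n : ℤ) = 0 := by omega
      have e2 : ¬ (n : ℤ) = -q := by omega
      by_cases hnq : n = q
      · subst hnq; simp [hn0]
      · have e1 : ¬ (n : ℤ) = q := by omega
        simp [hn0, hnq, e1, e2]
  set A : ℕ → ℕ → ℝ := fun q n =>
    if q ∣ n ∧ n ≠ 0 ∧ n ≠ q then (N q : ℝ) ^ 2 * ‖coeff φ n‖ ^ 2 else 0 with hA
  set B : ℕ → ℕ → ℝ := fun q n =>
    if q ∣ n then 0 else (‖geomChar a (N q) n‖ * ‖coeff φ n‖) ^ 2 with hB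
  have hsumm := summable_nat_mul_coeff_sq hC
  have hcs : Summable fun n : ℕ => ‖coeff φ n‖ ^ 2 :=
    ((hasSum_sq_norm_fourierCoeff (memLp_two_ofReal
      (memLp_two_of_continuous hφ))).summable).comp_injective Nat.cast_injective
  have hBle : ∀ᶠ q in 𝓕, ∀ n, ‖B q n‖ ≤ (2 * (n : ℝ) * ‖coeff φ n‖) ^ 2 := by
    filter_upwards [hest] with q ⟨hq, _, _, g2, g3⟩ n
    simp only [hB]
    split_ifs with hd
    · rw [norm_zero]; positivity
    · rw [Real.norm_eq_abs, abs_of_nonneg (by positivity)]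
      gcongr
      exact norm_geomChar_le_two_mul hq g2 g3 hα hd
  have hBlim : Tendsto (fun q => ∑' n, B q n) 𝓕 (nhds 0) := by
    have := tendsto_tsum_of_dominated_convergence (𝓕 := 𝓕) (f := B) (g := fun _ => 0) hsumm
      (fun n => ?_) hBle
    · simpa using this
    rcases Nat.eq_zero_or_pos n with rfl | hn
    · simp [hB]
    have hpos : 0 < ‖n • a‖ := norm_nsmul_pos hα hn.ne'
    have hlim : Tendsto (fun q : ℕ => (n / ‖n • a‖ * ‖coeff φ n‖ / (q : ℝ)) ^ 2) 𝓕 (nhds 0) := by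
      have := (tendsto_const_div_atTop_nhds_zero_nat (n / ‖n • a‖ * ‖coeff φ n‖)).mono_left hle
      simpa using this.pow 2
    refine squeeze_zero' (Eventually.of_forall fun q => by simp only [hB]; positivity) ?_ hlim
    filter_upwards [hest] with q ⟨hq, _, _, g2, g3⟩
    simp only [hB]
    split_ifs with hd
    · positivity
    · have h2 := norm_geomChar_mul_le a (N q) n
      rw [natCast_zsmul, Int.cast_natCast, Nat.abs_cast] at h2
      have hq0 : (0 : ℝ) < q := by exact_mod_cast hq.pos
      have h3 : ‖geomChar a (N q) n‖ ≤ n / ‖n • a‖ / q := by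
        rw [div_div, le_div_iff₀ (by positivity)]
        have h4 : 2 * (n : ℝ) * ‖N q • a‖ ≤ 2 * n * (1 / (2 * q)) := by gcongr
        have h5 : 2 * (n : ℝ) * (1 / (2 * q)) * q = n := by field_simp
        nlinarith [mul_le_mul_of_nonneg_right (h2.trans h4) hq0.le]
      calc (‖geomChar a (N q) n‖ * ‖coeff φ n‖) ^ 2 ≤ (n / ‖n • a‖ / q * ‖coeff φ n‖) ^ 2 := by
            gcongr
        _ = _ := by ring
  obtain ⟨Cm, hCm, hCm2⟩ := h1
  have hCm0 : Tendsto (fun q => 2 * (δ ^ 2 * |Cm q|)) 𝓕 (nhds 0) := by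
    have := (hCm.tendsto_atTop_zero.abs.const_mul (δ ^ 2)).const_mul 2
    simp only [abs_zero, mul_zero] at this
    exact this.mono_left hle
  have hRint : ∀ᶠ q in 𝓕, ∫ x, R q x ^ 2 ≤ 2 * (δ ^ 2 * |Cm q|) + 2 * ∑' n, B q n := by
    filter_upwards [hest, hle hCm2, hBle] with q ⟨hq, g0, g1, g2, g3⟩ hH hBq
    have hs := integral_sq_eq_two_mul_tsum (memLp_two_of_continuous (hRcont q))
      (by simpa using hRcoeff q hq.pos 0)
    rw [← hs.tsum_eq, tsum_mul_left, ← mul_add]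
    refine mul_le_mul_of_nonneg_left ?_ two_pos.le
    have hAs : Summable (A q) := by
      refine Summable.of_nonneg_of_le (fun n => by simp only [hA]; positivity) (fun n => ?_)
        (hcs.mul_left ((N q : ℝ) ^ 2))
      simp only [hA]
      split_ifs
      · exact le_rfl
      · positivity
    have hBs : Summable (B q) := Summable.of_norm_bounded hsumm hBq
    have hA1 := tsum_multiples_le (c := coeff φ) (N := N q) hq.pos hH
    have hA2 : (N q : ℝ) ^ 2 * (Cm q * ‖coeff φ q‖ ^ 2) ≤ δ ^ 2 * |Cm q| := by
      calc (N q : ℝ) ^ 2 * (Cm q * ‖coeff φ q‖ ^ 2) = (N q * ‖coeff φ q‖) ^ 2 * Cm q := by ring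
        _ ≤ (N q * ‖coeff φ q‖) ^ 2 * |Cm q| := by gcongr; exact le_abs_self _
        _ ≤ _ := by gcongr
    refine le_trans ?_ (add_le_add_left (hA1.trans hA2) _)
    rw [← hAs.tsum_add hBs]
    have hs2 : Summable fun n : ℕ => ‖coeff (R q) n‖ ^ 2 := by
      have := hs.summable.mul_left (1 / 2)
      simpa [← mul_assoc] using this
    refine hs2.tsum_le_tsum (fun n => ?_) (hAs.add hBs)
    rw [hRcoeff q hq.pos]
    simp only [hA, hB]
    by_cases c1 : n = 0 ∨ n = q
    · rw [if_pos c1, norm_zero, zero_pow two_ne_zero]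
      positivity
    · rw [if_neg c1, norm_mul]
      by_cases c2 : q ∣ n
      · rw [if_pos ⟨c2, not_or.1 c1⟩, if_pos c2, mul_pow, add_zero]
        gcongr
        exact norm_geomChar_le _ _ _
      · rw [if_neg c2, if_neg (fun h => c2 h.1), zero_add]
  have hRlim : Tendsto (fun q => 2 * (δ ^ 2 * |Cm q|) + 2 * ∑' n, B q n) 𝓕 (nhds 0) := by
    simpa using hCm0.add (hBlim.const_mul 2)
  -- contradiction
  set κ : ℝ := (2 * Real.pi * |ν| * (δ / 4)) ^ 2 / 2 with hκ
  have hκ0 : 0 < κ := by positivity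
  obtain ⟨η, hη, hKη⟩ := hK (κ / 2) (by positivity)
  set s : ℝ := κ / 2 / (2 * Real.pi * |ν|) with hs
  have hs0 : 0 < s := by positivity
  have hqη : ∀ᶠ q : ℕ in 𝓕, (1 / 2 : ℝ) / (q : ℝ) < η :=
    hle ((tendsto_const_div_atTop_nhds_zero_nat (1 / 2 : ℝ)).eventually_lt_const hη)
  obtain ⟨q, ⟨hq, g0, g1, g2, g3⟩, hRq, hsq, hqη⟩ :=
    (hest.and (hRint.and ((hRlim.eventually_le_const (by positivity : 0 < s ^ 2)).and hqη))).exists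
  have hK1 := hKη (N q) (g3.trans_lt (by rwa [← div_div]))
  have hRabs := integral_abs_le (hRcont q) hs0 (hRq.trans hsq)
  set w := geomChar a (N q) q * coeff φ q with hw
  have hZc : Continuous fun x => wave w q x + N q * (coeff φ 0).re :=
    (continuous_wave w q).add continuous_const
  have hmain := norm_expInt_le_add (continuous_bsum a hφ (N q)) hZc ν
  rw [norm_expInt_add_const] at hmain
  have hRe : ∫ x, |bsum a φ (N q) x - (wave w q x + N q * (coeff φ 0).re)| = ∫ x, |R q x| := by
    congr 1; ext x; simp only [hR, hw]; ring_nf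
  rw [hRe] at hmain
  have hpos : 0 < ‖q • a‖ := norm_nsmul_pos hα hq.pos.ne'
  have hwle : ‖w‖ ≤ δ := by
    rw [hw, norm_mul]
    refine le_trans ?_ g0
    gcongr
    exact norm_geomChar_le _ _ _
  have hwge : δ / 4 ≤ ‖w‖ := by
    rw [hw, norm_mul]
    have := le_norm_geomChar g2 hpos
    calc δ / 4 ≤ N q / 2 * ‖coeff φ q‖ := by linarith
      _ ≤ _ := by gcongr
  have hbes := norm_expInt_wave_le (ν := ν) (w := w) (q := q) (by exact_mod_cast hq.pos.ne')
    (le_trans (by gcongr) hδν)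
  have hκw : κ ≤ (2 * Real.pi * |ν| * ‖w‖) ^ 2 / 2 := by rw [hκ]; gcongr
  have hss : 2 * Real.pi * |ν| * ∫ x, |R q x| ≤ κ / 2 := by
    calc 2 * Real.pi * |ν| * ∫ x, |R q x| ≤ 2 * Real.pi * |ν| * s := by gcongr
      _ = κ / 2 := by rw [hs]; field_simp
  linarith

/-! ### Formal solutions -/

lemma norm_formalCoeff_neg (α : ℝ) (f : UnitAddCircle → ℝ) (m : ℤ) :
    ‖formalCoeff α f (-m)‖ = ‖formalCoeff α f m‖ := by
  rw [formalCoeff_eq, formalCoeff_eq]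
  by_cases hm : m = 0
  · simp [hm]
  · rw [if_neg hm, if_neg (by omega), norm_div, norm_div, norm_coeff_neg, fourier_neg]
    congr 1
    rw [← Complex.norm_conj]
    simp

lemma summable_formalCoeff_of_nat {α : ℝ} {f : UnitAddCircle → ℝ}
    (h : Summable fun n : ℕ => ‖formalCoeff α f n‖ ^ 2) :
    Summable fun m : ℤ => ‖formalCoeff α f m‖ ^ 2 :=
  Summable.of_nat_of_neg h (by simpa only [norm_formalCoeff_neg] using h)

lemma norm_formalCoeff_le {α : ℝ} (hα : Irrational α) (f : UnitAddCircle → ℝ) (n : ℕ) :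
    ‖formalCoeff α f n‖ ≤ ‖coeff f n‖ / ‖n • (α : UnitAddCircle)‖ := by
  rw [formalCoeff_eq]
  split_ifs with hn
  · rw [norm_zero]; positivity
  · rw [norm_div]
    have h := norm_zsmul_pos hα hn
    have h2 := le_norm_fourier_sub_one n (α : UnitAddCircle)
    rw [natCast_zsmul] at h h2
    gcongr
    linarith

/-- The formal solution is square-summable away from the good denominators. -/
lemma summable_ratio_off_goodDenom {α : ℝ} (hα : Irrational α) {c : ℤ → ℂ} {C : ℝ}
    (hC : ∀ m : ℤ, ‖c m‖ * |(m : ℝ)| ^ 3 ≤ C) (hcs : Summable fun n : ℕ => ‖c n‖ ^ 2) {J : ℕ}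
    (hratio : ∀ q, IsGoodDenom α q → J ≤ q → ‖c q‖ ≤ ‖q • (α : UnitAddCircle)‖)
    {Cm : ℕ → ℝ} (hCm : Summable Cm)
    (hH : ∀ q : ℕ, J ≤ q → ∑' l : ℕ, ‖c ((l + 2) * q)‖ ^ 2 ≤ Cm q * ‖c q‖ ^ 2) :
    Summable fun n : ℕ => {n | ¬ (IsGoodDenom α n ∧ J ≤ n)}.indicator
      (fun n : ℕ => (‖c n‖ / ‖n • (α : UnitAddCircle)‖) ^ 2) n := by
  classical
  set a : UnitAddCircle := (α : UnitAddCircle)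
  set g : ℕ × ℕ → ℝ := fun p =>
    if IsGoodDenom α p.1 ∧ J ≤ p.1 then (‖c ((p.2 + 2) * p.1)‖ / ‖p.1 • a‖) ^ 2 else 0 with hg
  have hg0 : 0 ≤ g := fun p => by simp only [hg]; positivity
  have hgs : Summable g := by
    have hinner : ∀ q : ℕ, 0 < q → Summable fun l : ℕ => ‖c ((l + 2) * q)‖ ^ 2 := by
      intro q hq
      have hinj : Function.Injective fun l : ℕ => (l + 2) * q := fun x y h => by
        have := Nat.eq_of_mul_eq_mul_right hq h
        omega
      have := hcs.comp_injective hinj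
      simpa [Function.comp_def] using this
    rw [summable_prod_of_nonneg hg0]
    constructor
    · intro q
      by_cases hq : IsGoodDenom α q ∧ J ≤ q
      · simp only [hg, hq, and_self, if_true, div_pow]
        exact (hinner q hq.1.pos).div_const _
      · simp only [hg, hq, if_false]
        exact summable_zero
    · refine Summable.of_nonneg_of_le (fun q => tsum_nonneg fun l => hg0 _) (fun q => ?_) hCm.abs
      by_cases hq : IsGoodDenom α q ∧ J ≤ q
      · simp only [hg, hq, and_self, if_true, div_pow]
        have hpos : 0 < ‖q • a‖ := norm_nsmul_pos hα hq.1.pos.ne'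
        rw [tsum_div_const, div_le_iff₀ (by positivity)]
        have h1 := hratio q hq.1 hq.2
        calc _ ≤ Cm q * ‖c q‖ ^ 2 := hH q hq.2
          _ ≤ |Cm q| * ‖c q‖ ^ 2 := by gcongr; exact le_abs_self _
          _ ≤ _ := by gcongr
      · simp only [hg, hq, if_false]
        simp
  set P : ℕ → ℕ × ℕ → Prop := fun n p =>
    (IsGoodDenom α p.1 ∧ J ≤ p.1) ∧ n = (p.2 + 2) * p.1 ∧ ‖p.1 • a‖ ≤ ‖n • a‖ with hP
  set v : ℕ → ℝ := {n | ∃ p, P n p}.indicator (fun n => (‖c n‖ / ‖n • a‖) ^ 2) with hv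
  have hvs : Summable v := by
    rw [hv, ← summable_subtype_iff_indicator]
    have hinj : Function.Injective fun n : {n | ∃ p, P n p} => n.2.choose := by
      intro n m h
      have h1 := n.2.choose_spec.2.1
      have h2 := m.2.choose_spec.2.1
      simp only at h
      rw [h] at h1
      exact Subtype.ext (h1.trans h2.symm)
    refine Summable.of_nonneg_of_le (fun n => by simp only [Function.comp]; positivity) (fun n => ?_)
      (hgs.comp_injective hinj)
    obtain ⟨h1, h2, h3⟩ := n.2.choose_spec
    simp only [Function.comp, hg]
    rw [if_pos h1]
    have hpos : 0 < ‖n.2.choose.1 • a‖ := norm_nsmul_pos hα h1.1.pos.ne'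
    have e : c ((n : ℕ) : ℤ) = c ((n.2.choose.2 + 2) * n.2.choose.1) := by
      conv_lhs => rw [h2]
      push_cast; rfl
    rw [e]
    gcongr
  set K : ℝ := ∑ q ∈ Finset.Ioo 0 J, (1 / ‖q • a‖) ^ 2 with hK
  have htot := ((Real.summable_one_div_nat_pow.2 (by norm_num : 1 < 2)).mul_left (C ^ 2)).add
    ((hcs.mul_left K).add hvs)
  have hC0 : 0 ≤ C := by simpa using hC 0
  refine Summable.of_nonneg_of_le (fun n => Set.indicator_nonneg (fun _ _ => by positivity) _)
    (fun n => ?_) htot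
  have hK0 : 0 ≤ K := Finset.sum_nonneg fun _ _ => by positivity
  have hv0 : 0 ≤ v n := Set.indicator_nonneg (fun _ _ => by positivity) _
  have hb0 : 0 ≤ C ^ 2 * (1 / (n : ℝ) ^ 2) := by positivity
  have hb1 : 0 ≤ K * ‖c n‖ ^ 2 := by positivity
  by_cases hn : n ∈ {n | ¬ (IsGoodDenom α n ∧ J ≤ n)}
  swap
  · rw [Set.indicator_of_notMem hn]; positivity
  rw [Set.indicator_of_mem hn]
  rcases Nat.eq_zero_or_pos n with rfl | hn0
  · simp only [zero_smul, norm_zero, div_zero, ne_eq, OfNat.ofNat_ne_zero, not_false_eq_true,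
      zero_pow]
    positivity
  have hnpos : 0 < ‖n • a‖ := norm_nsmul_pos hα hn0.ne'
  have hn1 : (0 : ℝ) < n := by exact_mod_cast hn0
  by_cases hclose : ‖n • a‖ < 1 / (n : ℝ) ^ 2
  · obtain ⟨q, l, hq, hl, hnl, hnorm⟩ := exists_isGoodDenom hn0 hclose
    have hl1 : (1 : ℝ) ≤ l := by exact_mod_cast hl
    have hqpos : 0 < ‖q • a‖ := norm_nsmul_pos hα hq.pos.ne'
    have hqn : ‖q • a‖ ≤ ‖n • a‖ := by
      rw [hnorm]; exact le_mul_of_one_le_left hqpos.le hl1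
    by_cases hqJ : J ≤ q
    · have hl2 : l ≠ 1 := by
        rintro rfl
        rw [one_mul] at hnl
        subst hnl
        exact hn ⟨hq, hqJ⟩
      have hmem : n ∈ {n | ∃ p, P n p} := by
        refine ⟨(q, l - 2), ⟨hq, hqJ⟩, ?_, hqn⟩
        simp only
        rw [Nat.sub_add_cancel (by omega)]
        exact hnl
      have : v n = (‖c n‖ / ‖n • a‖) ^ 2 := Set.indicator_of_mem hmem _
      linarith
    · have h1 : (1 / ‖q • a‖) ^ 2 ≤ K :=
        Finset.single_le_sum (f := fun q => (1 / ‖q • a‖) ^ 2) (fun _ _ => by positivity)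
          (Finset.mem_Ioo.2 ⟨hq.pos, not_le.1 hqJ⟩)
      have : (‖c n‖ / ‖n • a‖) ^ 2 ≤ K * ‖c n‖ ^ 2 := by
        calc (‖c n‖ / ‖n • a‖) ^ 2 ≤ (‖c n‖ / ‖q • a‖) ^ 2 := by gcongr
          _ = (1 / ‖q • a‖) ^ 2 * ‖c n‖ ^ 2 := by ring
          _ ≤ _ := by gcongr
      linarith
  · push Not at hclose
    have h1 := hC n
    rw [Int.cast_natCast, Nat.abs_cast] at h1
    have h3 : ‖c n‖ / ‖n • a‖ ≤ C / n := by
      rw [div_le_div_iff₀ hnpos hn1]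
      calc ‖c n‖ * n = ‖c n‖ * n ^ 3 * (1 / (n : ℝ) ^ 2) := by field_simp
        _ ≤ C * ‖n • a‖ := by gcongr
    have : (‖c n‖ / ‖n • a‖) ^ 2 ≤ C ^ 2 * (1 / (n : ℝ) ^ 2) := by
      calc (‖c n‖ / ‖n • a‖) ^ 2 ≤ (C / n) ^ 2 := by gcongr
        _ = _ := by ring
    linarith

/-! ### Series of waves -/

/-- The series `∑ 2 Re (b_n e^{2 π i n x})`. -/
def waveSeries (b : ℕ → ℂ) (x : UnitAddCircle) : ℝ := ∑' n : ℕ, wave (b n) n x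

lemma continuous_waveSeries {b : ℕ → ℂ} (hb : Summable fun n => ‖b n‖) :
    Continuous (waveSeries b) :=
  continuous_tsum (fun n => continuous_wave _ _) (hb.mul_left 2)
    (fun n x => by rw [Real.norm_eq_abs]; exact abs_wave_le _ _ _)

lemma summable_wave {b : ℕ → ℂ} (hb : Summable fun n => ‖b n‖) (x : UnitAddCircle) :
    Summable fun n : ℕ => wave (b n) n x :=
  Summable.of_norm_bounded (hb.mul_left 2)
    (fun n => by rw [Real.norm_eq_abs]; exact abs_wave_le _ _ _)

lemma coeff_waveSeries {b : ℕ → ℂ} (hb : Summable fun n => ‖b n‖) (h0 : b 0 = 0) (n : ℕ) :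
    coeff (waveSeries b) n = b n := by
  have hint : ∀ k : ℕ, Integrable fun x : UnitAddCircle =>
      (fourier (-(n : ℤ)) x : ℂ) * (wave (b k) k x : ℂ) := fun k => by
    have := continuous_wave (b k) k
    exact integrable_of_continuous (by fun_prop)
  have hle : ∀ (k : ℕ) (x : UnitAddCircle),
      ‖(fourier (-(n : ℤ)) x : ℂ) * (wave (b k) k x : ℂ)‖ ≤ 2 * ‖b k‖ := fun k x => by
    rw [norm_mul, norm_fourier_apply, one_mul, Complex.norm_real, Real.norm_eq_abs]
    exact abs_wave_le _ _ _
  have hs : Summable fun k : ℕ => ∫ x : UnitAddCircle,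
      ‖(fourier (-(n : ℤ)) x : ℂ) * (wave (b k) k x : ℂ)‖ := by
    refine Summable.of_nonneg_of_le (fun k => integral_nonneg fun x => norm_nonneg _) (fun k => ?_)
      (hb.mul_left 2)
    have := integral_mono (hint k).norm (integrable_const (2 * ‖b k‖)) (hle k)
    simpa using this
  have key := hasSum_integral_of_summable_integral_norm hint hs
  have e1 : coeff (waveSeries b) n
      = ∫ x : UnitAddCircle, ∑' k : ℕ, (fourier (-(n : ℤ)) x : ℂ) * (wave (b k) k x : ℂ) := by
    rw [coeff, fourierCoeff_eq]
    congr 1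
    ext x
    rw [tsum_mul_left, waveSeries, Complex.ofReal_tsum]
  rw [e1, ← key.tsum_eq]
  have e2 : ∀ k : ℕ, ∫ x : UnitAddCircle, (fourier (-(n : ℤ)) x : ℂ) * (wave (b k) k x : ℂ)
      = if k = n then b n else 0 := by
    intro k
    rw [← fourierCoeff_eq]
    by_cases hk : k = 0
    · subst hk
      have : ∀ x, wave (b 0) (0 : ℕ) x = 0 := fun x => by simp [wave, h0]
      simp only [this]
      rw [fourierCoeff_eq]
      split_ifs with h
      · subst h; simp [h0]
      · simp
    · have := fourierCoeff_wave (b k) (q := k) (by exact_mod_cast hk) n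
      rw [coeff] at this
      rw [this]
      by_cases hkn : k = n
      · subst hkn; simp
      · have e1 : ¬ (n : ℤ) = k := by omega
        have e2 : ¬ (n : ℤ) = -k := by omega
        simp [hkn, e1, e2]
  simp only [e2]
  exact tsum_ite_eq n (fun _ => b n)

lemma bsum_waveSeries {b : ℕ → ℂ} (hb : Summable fun n => ‖b n‖) (a : UnitAddCircle) (N : ℕ)
    (x : UnitAddCircle) :
    bsum a (waveSeries b) N x = ∑' n : ℕ, wave (b n * geomChar a N n) n x := by
  simp only [← bsum_wave]
  rw [bsum]
  simp only [waveSeries, bsum]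
  rw [Summable.tsum_finsetSum fun k _ => summable_wave hb _]

/-! ### Many scales -/

/-- A time at which the Birkhoff sums of a sparse series are close to a wave of frequency `q`. -/
def scaleTime (α : ℝ) (q : ℕ) : ℕ := ⌊1 / (2 * q * ‖q • (α : UnitAddCircle)‖)⌋₊ * q

lemma scaleTime_spec {α : ℝ} (hα : Irrational α) {q : ℕ} (hq : IsGoodDenom α q) (h32 : 32 ≤ q) :
    scaleTime α q * ‖q • (α : UnitAddCircle)‖ ≤ 1 / 2 ∧
    1 / 4 ≤ scaleTime α q * ‖q • (α : UnitAddCircle)‖ ∧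
    ‖scaleTime α q • (α : UnitAddCircle)‖ ≤ 1 / (2 * q) := by
  have hpos : 0 < ‖q • (α : UnitAddCircle)‖ := norm_nsmul_pos hα hq.pos.ne'
  have hq32 : (32 : ℝ) ≤ q := by exact_mod_cast h32
  have hq0 : (0 : ℝ) < q := by linarith
  set k := ⌊1 / (2 * q * ‖q • (α : UnitAddCircle)‖)⌋₊ with hk
  have f1 := Nat.floor_le (a := 1 / (2 * q * ‖q • (α : UnitAddCircle)‖)) (by positivity)
  have f2 := Nat.lt_floor_add_one (1 / (2 * q * ‖q • (α : UnitAddCircle)‖))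
  rw [le_div_iff₀ (by positivity), ← hk] at f1
  rw [div_lt_iff₀ (by positivity), ← hk] at f2
  have e : (scaleTime α q : ℝ) = k * q := by simp [scaleTime, hk]
  have hc : q * ‖q • (α : UnitAddCircle)‖ ≤ 1 / 4 := by
    have h1 := hq.close
    calc q * ‖q • (α : UnitAddCircle)‖ ≤ q * (1 / (q : ℝ) ^ 2) := by gcongr
      _ = 1 / q := by field_simp
      _ ≤ 1 / 4 := by gcongr; linarith
  refine ⟨by rw [e]; linarith, by rw [e]; linarith, ?_⟩
  have : ‖scaleTime α q • (α : UnitAddCircle)‖ ≤ k * ‖q • (α : UnitAddCircle)‖ := by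
    rw [scaleTime, mul_smul]
    exact norm_nsmul_le (n := k) (a := q • (α : UnitAddCircle))
  refine this.trans ?_
  rw [le_div_iff₀ (by positivity)]
  linarith

lemma abs_bsum_waveSeries_sub_le {α : ℝ} (hα : Irrational α) {b : ℕ → ℂ} {C : ℝ}
    (hC : ∀ n : ℕ, ‖b n‖ * (n : ℝ) ^ 3 ≤ C) (hb : Summable fun n => ‖b n‖)
    (hsupp : ∀ n, b n ≠ 0 → IsGoodDenom α n ∧ 32 ≤ n ∧ ‖b n‖ ≤ ‖n • (α : UnitAddCircle)‖)
    {q : ℕ} (hq : IsGoodDenom α q) (h32 : 32 ≤ q) (x : UnitAddCircle) :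
    |bsum (α : UnitAddCircle) (waveSeries b) (scaleTime α q) x
      - wave (b q * geomChar (α : UnitAddCircle) (scaleTime α q) q) q x| ≤ (6 + 4 * C) * (1 / √q) := by
  classical
  set a : UnitAddCircle := (α : UnitAddCircle)
  set N := scaleTime α q
  obtain ⟨g1, g2, g3⟩ := scaleTime_spec hα hq h32
  have hq32 : (32 : ℝ) ≤ q := by exact_mod_cast h32
  have hq0 : (0 : ℝ) < q := by linarith
  have hC0 : 0 ≤ C := by have := hC 0; simpa using this
  set u : ℕ → ℝ := fun n => wave (b n * geomChar a N n) n x with hu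
  have hub : ∀ n, ‖u n‖ ≤ 2 * (‖b n‖ * ‖geomChar a N n‖) := fun n => by
    rw [Real.norm_eq_abs, ← norm_mul]; exact abs_wave_le _ _ _
  have hus : Summable u := by
    refine Summable.of_norm_bounded (hb.mul_left (2 * (N : ℝ))) fun n => (hub n).trans ?_
    have := norm_geomChar_le a N n
    calc 2 * (‖b n‖ * ‖geomChar a N n‖) ≤ 2 * (‖b n‖ * N) := by gcongr
      _ = _ := by ring
  rw [bsum_waveSeries hb, hus.tsum_eq_add_tsum_ite q, add_sub_cancel_left]
  have hterm : ∀ n, ‖if n = q then 0 else u n‖ ≤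
      (if IsGoodDenom α n ∧ 32 ≤ n ∧ n < q then 2 / (q : ℝ) * n else 0)
      + (if q < n then 2 * C * ((n : ℝ) ^ 2)⁻¹ else 0) := by
    intro n
    have p1 : 0 ≤ (if IsGoodDenom α n ∧ 32 ≤ n ∧ n < q then 2 / (q : ℝ) * n else 0) := by positivity
    have p2 : 0 ≤ (if q < n then 2 * C * ((n : ℝ) ^ 2)⁻¹ else 0) := by positivity
    by_cases hbn : b n = 0
    · have : u n = 0 := by simp [hu, wave, hbn]
      rw [this, ite_self, norm_zero]
      exact add_nonneg p1 p2
    obtain ⟨hn, hn32, hnb⟩ := hsupp n hbn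
    have hnpos : 0 < ‖n • a‖ := norm_nsmul_pos hα hn.pos.ne'
    have hn0 : (0 : ℝ) < n := by exact_mod_cast hn.pos
    rcases lt_trichotomy n q with hlt | heq | hgt
    · rw [if_neg hlt.ne, if_pos ⟨hn, hn32, hlt⟩, if_neg hlt.not_gt, add_zero]
      refine (hub n).trans ?_
      have h2 := norm_geomChar_mul_le a N n
      rw [natCast_zsmul, Int.cast_natCast, Nat.abs_cast] at h2
      calc 2 * (‖b n‖ * ‖geomChar a N n‖) ≤ 2 * (‖n • a‖ * ‖geomChar a N n‖) := by gcongr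
        _ ≤ 2 * (2 * n * ‖N • a‖) := by linarith
        _ ≤ 2 * (2 * n * (1 / (2 * q))) := by gcongr
        _ = _ := by field_simp
    · rw [if_pos heq, norm_zero]; exact add_nonneg p1 p2
    · rw [if_neg hgt.ne', if_neg (fun h => hgt.not_gt h.2.2), if_pos hgt, zero_add]
      refine (hub n).trans ?_
      have h2 := hq.norm_ge_of_lt hn hgt
      have hN : (N : ℝ) ≤ n := by
        have h3 : (N : ℝ) * (1 / (2 * n)) ≤ 1 / 2 := le_trans (by gcongr) g1
        rw [mul_one_div, div_le_div_iff₀ (by positivity) two_pos] at h3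
        linarith
      have h4 := norm_geomChar_le a N n
      calc 2 * (‖b n‖ * ‖geomChar a N n‖) ≤ 2 * (‖b n‖ * n) := by gcongr; exact h4.trans hN
        _ = 2 * (‖b n‖ * n ^ 3) * ((n : ℝ) ^ 2)⁻¹ := by field_simp
        _ ≤ 2 * C * ((n : ℝ) ^ 2)⁻¹ := by gcongr; exact hC n
  have hfin : ∀ s : Finset ℕ, ∑ n ∈ s, ‖if n = q then 0 else u n‖ ≤ (6 + 4 * C) * (1 / √q) := by
    intro s
    refine (Finset.sum_le_sum fun n _ => hterm n).trans ?_
    rw [Finset.sum_add_distrib, ← Finset.sum_filter, ← Finset.sum_filter, ← Finset.mul_sum,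
      ← Finset.mul_sum]
    have h1 := sum_sq_le_of_goodDenom (s.filter fun n => IsGoodDenom α n ∧ 32 ≤ n ∧ n < q) q hq
      (fun p hp => (Finset.mem_filter.1 hp).2)
    have h2 : ∑ n ∈ s.filter (fun n => q < n), ((n : ℝ) ^ 2)⁻¹ ≤ 2 / (q + 1) := by
      refine le_trans ?_ (sum_Ioo_inv_sq_le q (s.sup id + 1))
      refine Finset.sum_le_sum_of_subset_of_nonneg (fun n hn => ?_) (fun _ _ _ => by positivity)
      rw [Finset.mem_filter] at hn
      exact Finset.mem_Ioo.2 ⟨hn.2, Nat.lt_succ_of_le (Finset.le_sup (f := id) hn.1)⟩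
    have hsq : √(q : ℝ) * √q = q := Real.mul_self_sqrt hq0.le
    have hsq0 : 0 < √(q : ℝ) := Real.sqrt_pos.2 hq0
    have hsq1 : 1 ≤ √(q : ℝ) := Real.one_le_sqrt.2 (by linarith)
    have h3 : 2 / (q : ℝ) * (3 * √q) = 6 * (1 / √q) := by
      nth_rewrite 1 [← hsq]; field_simp; norm_num
    have h4 : 2 / ((q : ℝ) + 1) ≤ 2 * (1 / √q) := by
      rw [mul_one_div]; gcongr; nlinarith
    calc _ ≤ 2 / (q : ℝ) * (3 * √q) + 2 * C * (2 * (1 / √q)) := by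
          gcongr
          exact h2.trans h4
      _ = _ := by rw [h3]; ring
  have hns : Summable fun n => ‖if n = q then 0 else u n‖ :=
    summable_of_sum_le (fun _ => norm_nonneg _) hfin
  rw [← Real.norm_eq_abs]
  exact (norm_tsum_le_tsum_norm hns).trans (hns.tsum_le_of_sum_le hfin)

lemma exists_bsum_near_sum_wave {α : ℝ} (hα : Irrational α) {b : ℕ → ℂ} {C : ℝ}
    (hC : ∀ n : ℕ, ‖b n‖ * (n : ℝ) ^ 3 ≤ C) (hb : Summable fun n => ‖b n‖)
    (hsupp : ∀ n, b n ≠ 0 → IsGoodDenom α n ∧ 32 ≤ n ∧ ‖b n‖ ≤ ‖n • (α : UnitAddCircle)‖)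
    (F : Finset ℕ) (hF : ∀ q ∈ F, IsGoodDenom α q ∧ 32 ≤ q) :
    ∃ w : ℕ → ℂ, (∀ q ∈ F, ‖b q‖ / ‖q • (α : UnitAddCircle)‖ ≤ 8 * ‖w q‖ ∧
        2 * ‖w q‖ ≤ ‖b q‖ / ‖q • (α : UnitAddCircle)‖) ∧
      ∀ x, |bsum (α : UnitAddCircle) (waveSeries b) (∑ q ∈ F, scaleTime α q) x
        - ∑ q ∈ F, wave (w q) q x| ≤ (6 + 4 * C) * ∑ q ∈ F, 1 / √(q : ℝ) := by
  classical
  set a : UnitAddCircle := (α : UnitAddCircle)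
  induction F using Finset.induction_on with
  | empty => exact ⟨0, by simp, fun x => by simp [bsum]⟩
  | insert q s hqs ih =>
    obtain ⟨w, hw1, hw2⟩ := ih fun p hp => hF p (Finset.mem_insert_of_mem hp)
    obtain ⟨hq, h32⟩ := hF q (Finset.mem_insert_self _ _)
    obtain ⟨g1, g2, g3⟩ := scaleTime_spec hα hq h32
    have hpos : 0 < ‖q • a‖ := norm_nsmul_pos hα hq.pos.ne'
    set M := ∑ p ∈ s, scaleTime α p
    set N := scaleTime α q
    set w' : ℂ := b q * geomChar a N q * fourier (q : ℤ) (M • a) with hw'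
    have hnw : ‖w'‖ = ‖b q‖ * ‖geomChar a N q‖ := by
      rw [hw', norm_mul, norm_fourier_apply, mul_one, norm_mul]
    refine ⟨Function.update w q w', fun p hp => ?_, fun x => ?_⟩
    · rcases Finset.mem_insert.1 hp with rfl | hp
      · rw [Function.update_self, hnw]
        have k1 := norm_geomChar_le a N p
        have k2 := le_norm_geomChar g1 hpos
        constructor
        · rw [div_le_iff₀ hpos]
          have : 1 ≤ 8 * ‖geomChar a N p‖ * ‖p • a‖ := by
            nlinarith [mul_le_mul_of_nonneg_right k2 hpos.le]
          calc ‖b p‖ = ‖b p‖ * 1 := (mul_one _).symm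
            _ ≤ ‖b p‖ * (8 * ‖geomChar a N p‖ * ‖p • a‖) := by gcongr
            _ = _ := by ring
        · rw [le_div_iff₀ hpos]
          have : 2 * ‖geomChar a N p‖ * ‖p • a‖ ≤ 1 := by
            nlinarith [mul_le_mul_of_nonneg_right k1 hpos.le]
          calc 2 * (‖b p‖ * ‖geomChar a N p‖) * ‖p • a‖
              = ‖b p‖ * (2 * ‖geomChar a N p‖ * ‖p • a‖) := by ring
            _ ≤ ‖b p‖ * 1 := by gcongr
            _ = _ := mul_one _
      · rw [Function.update_of_ne (ne_of_mem_of_not_mem hp hqs)]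
        exact hw1 p hp
    · rw [Finset.sum_insert hqs, Finset.sum_insert hqs, Finset.sum_insert hqs, add_comm (scaleTime α q),
        bsum_add, Function.update_self]
      have hsum : ∑ p ∈ s, wave (Function.update w q w' p) p x = ∑ p ∈ s, wave (w p) p x :=
        Finset.sum_congr rfl fun p hp => by
          rw [Function.update_of_ne (ne_of_mem_of_not_mem hp hqs)]
      rw [hsum]
      have h1 := hw2 x
      have h2 := abs_bsum_waveSeries_sub_le hα hC hb hsupp hq h32 (x + M • a)
      rw [wave_add] at h2
      have e : bsum a (waveSeries b) M x + bsum a (waveSeries b) N (x + M • a)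
          - (wave w' q x + ∑ p ∈ s, wave (w p) p x)
          = (bsum a (waveSeries b) N (x + M • a) - wave w' q x)
            + (bsum a (waveSeries b) M x - ∑ p ∈ s, wave (w p) p x) := by ring
      rw [e, mul_add]
      exact (abs_add_le _ _).trans (add_le_add h2 h1)

/-- If `e^{2 π i ν (Φ + c)}` is a multiplicative coboundary for the sparse series `Φ`, its formal
solution is square-summable. -/
lemma exists_summable_ratio {α : ℝ} (hα : Irrational α) {b : ℕ → ℂ} {C : ℝ}
    (hC : ∀ n : ℕ, ‖b n‖ * (n : ℝ) ^ 3 ≤ C) (hb : Summable fun n => ‖b n‖) {ν : ℝ} (hν : ν ≠ 0)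
    (hsupp : ∀ n, b n ≠ 0 → IsGoodDenom α n ∧ 32 ≤ n ∧ ‖b n‖ ≤ ‖n • (α : UnitAddCircle)‖ ∧
      4 * Real.pi * |ν| * (‖b n‖ / ‖n • (α : UnitAddCircle)‖) ≤ 1)
    {δ : ℝ} (hδ : 0 < δ)
    (hK : ∀ N : ℕ, ‖N • (α : UnitAddCircle)‖ < δ →
      1 / 2 < ‖expInt ν (bsum (α : UnitAddCircle) (waveSeries b) N)‖) :
    ∃ g : ℕ → ℝ, Summable g ∧ ∀ᶠ n : ℕ in atTop, (‖b n‖ / ‖n • (α : UnitAddCircle)‖) ^ 2 ≤ g n := by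
  classical
  set a : UnitAddCircle := (α : UnitAddCircle)
  have hC0 : 0 ≤ C := by have := hC 0; simpa using this
  have hν0 : 0 < |ν| := abs_pos.2 hν
  have hpi := Real.pi_pos
  set B : ℝ := 12 + 2 * Real.pi * |ν| * (6 + 4 * C) with hB
  have hB0 : 0 < B := by positivity
  obtain ⟨J, hJ32, hJδ, hJB⟩ : ∃ J : ℕ, 32 ≤ J ∧ 2 / √(J : ℝ) < δ ∧ B * (2 / √(J : ℝ)) < 1 / 4 := by
    have hlim : Tendsto (fun J : ℕ => 2 / √(J : ℝ)) atTop (nhds 0) :=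
      (Real.tendsto_sqrt_atTop.comp tendsto_natCast_atTop_atTop).const_div_atTop 2
    have hlim2 := hlim.const_mul B
    rw [mul_zero] at hlim2
    exact ((eventually_ge_atTop 32).and ((hlim.eventually_lt_const hδ).and
      (hlim2.eventually_lt_const (by norm_num)))).exists
  refine ⟨fun n => if b n ≠ 0 ∧ J ≤ n then (‖b n‖ / ‖n • a‖) ^ 2 else 0, ?_, ?_⟩
  swap
  · filter_upwards [eventually_ge_atTop J] with n hn
    by_cases hbn : b n = 0
    · simp [hbn]
    · simp [hbn, hn]
  refine summable_of_sum_le (c := 128 * Real.log 4 / (2 * Real.pi * |ν|) ^ 2)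
    (fun n => by positivity) fun s => ?_
  rw [← Finset.sum_filter]
  set F := s.filter (fun n => b n ≠ 0 ∧ J ≤ n) with hF
  have hFm : ∀ q ∈ F, b q ≠ 0 ∧ J ≤ q := fun q hq => (Finset.mem_filter.1 hq).2
  obtain ⟨w, hw1, hw2⟩ := exists_bsum_near_sum_wave hα hC hb
    (fun n hn => ⟨(hsupp n hn).1, (hsupp n hn).2.1, (hsupp n hn).2.2.1⟩) F
    (fun q hq => ⟨(hsupp q (hFm q hq).1).1, (hsupp q (hFm q hq).1).2.1⟩)
  set N := ∑ q ∈ F, scaleTime α q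
  have hinv := sum_inv_sqrt_le_of_goodDenom (α := α) F J hJ32
    (fun q hq => ⟨(hsupp q (hFm q hq).1).1, (hFm q hq).2⟩)
  have hNa : ‖N • a‖ < δ := by
    refine lt_of_le_of_lt ?_ hJδ
    rw [Finset.sum_smul]
    refine (norm_sum_le _ _).trans (le_trans (Finset.sum_le_sum fun q hq => ?_) hinv)
    obtain ⟨h1, h2, -⟩ := hsupp q (hFm q hq).1
    refine (scaleTime_spec hα h1 h2).2.2.trans ?_
    have hq0 : (0 : ℝ) < q := by exact_mod_cast h1.pos
    have hq1 : (1 : ℝ) ≤ q := by exact_mod_cast h1.pos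
    have : √(q : ℝ) ≤ 2 * q := by
      have : √(q : ℝ) ≤ q := Real.sqrt_le_iff.2 ⟨hq0.le, by nlinarith⟩
      linarith
    have h0 : 0 < √(q : ℝ) := Real.sqrt_pos.2 hq0
    gcongr
  have hKN := hK N hNa
  have hYc : Continuous fun x => ∑ q ∈ F, wave (w q) q x :=
    continuous_finsetSum _ fun p _ => continuous_wave _ _
  have hΦc : Continuous (bsum a (waveSeries b) N) := continuous_bsum a (continuous_waveSeries hb) N
  have h1 := norm_expInt_le_add hΦc hYc ν
  have h2 : ∫ x, |bsum a (waveSeries b) N x - ∑ q ∈ F, wave (w q) q x|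
      ≤ (6 + 4 * C) * ∑ q ∈ F, 1 / √(q : ℝ) := by
    have := integral_mono (integrable_of_continuous (hΦc.sub hYc).abs)
      (integrable_const ((6 + 4 * C) * ∑ q ∈ F, 1 / √(q : ℝ))) hw2
    simpa using this
  have h3 := norm_expInt_sum_wave_le (α := α) (ν := ν) w F (fun q hq => by
    obtain ⟨k1, k2, k3, k4⟩ := hsupp q (hFm q hq).1
    refine ⟨k1, k2, ?_⟩
    have k5 := (hw1 q hq).2
    have : 2 * Real.pi * |ν| * (2 * ‖w q‖) ≤ 2 * Real.pi * |ν| * (‖b q‖ / ‖q • a‖) := by gcongr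
    linarith)
  have h4 : 2 * Real.pi * |ν| * ∫ x, |bsum a (waveSeries b) N x - ∑ q ∈ F, wave (w q) q x|
      ≤ 2 * Real.pi * |ν| * ((6 + 4 * C) * ∑ q ∈ F, 1 / √(q : ℝ)) := by gcongr
  have h5 : B * ∑ q ∈ F, 1 / √(q : ℝ) < 1 / 4 := lt_of_le_of_lt (by gcongr) hJB
  have h6 : 12 * (∑ q ∈ F, 1 / √(q : ℝ)) + 2 * Real.pi * |ν| * ((6 + 4 * C) * ∑ q ∈ F, 1 / √(q : ℝ))
      = B * ∑ q ∈ F, 1 / √(q : ℝ) := by rw [hB]; ring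
  have h7 : 1 / 4 < Real.exp (-∑ q ∈ F, (2 * Real.pi * |ν| * ‖w q‖) ^ 2 / 2) := by linarith
  have h8 : ∑ q ∈ F, (2 * Real.pi * |ν| * ‖w q‖) ^ 2 / 2 ≤ Real.log 4 := by
    have := Real.log_lt_log (by norm_num) h7
    rw [Real.log_exp, one_div, Real.log_inv] at this
    linarith
  rw [le_div_iff₀ (by positivity), Finset.sum_mul]
  calc ∑ q ∈ F, (‖b q‖ / ‖q • a‖) ^ 2 * (2 * Real.pi * |ν|) ^ 2
      ≤ ∑ q ∈ F, 128 * ((2 * Real.pi * |ν| * ‖w q‖) ^ 2 / 2) := by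
        refine Finset.sum_le_sum fun q hq => ?_
        have := (hw1 q hq).1
        calc (‖b q‖ / ‖q • a‖) ^ 2 * (2 * Real.pi * |ν|) ^ 2
            ≤ (8 * ‖w q‖) ^ 2 * (2 * Real.pi * |ν|) ^ 2 := by gcongr
          _ = _ := by ring
    _ = 128 * ∑ q ∈ F, (2 * Real.pi * |ν| * ‖w q‖) ^ 2 / 2 := by rw [Finset.mul_sum]
    _ ≤ _ := by gcongr

/-- If `e^{2 π i ν φ}` is a multiplicative coboundary for some `ν ≠ 0`, then the formal solution of
the additive cohomological equation for `φ` is square-summable. -/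
theorem summable_formalCoeff_of_cocycle {α : ℝ} (hα : Irrational α) {φ : UnitAddCircle → ℝ}
    (hφ : ContDiff ℝ 3 (fun x : ℝ => φ (x : UnitAddCircle))) (h1 : H1 φ) {ν : ℝ} (hν : ν ≠ 0)
    {G : UnitAddCircle → ℂ} (hGm : Measurable G) (hG1 : ∀ᵐ x, ‖G x‖ = 1)
    (hG : ∀ᵐ x, G (x + (α : UnitAddCircle))
      = Complex.exp (2 * Real.pi * Complex.I * ν * φ x) * G x) :
    Summable fun m : ℤ => ‖formalCoeff α φ m‖ ^ 2 := by
  classical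
  set a : UnitAddCircle := (α : UnitAddCircle)
  have hφc : Continuous φ := continuous_of_continuous_coe hφ.continuous
  obtain ⟨C, hC0, hC⟩ := exists_coeff_le hφ
  have hν0 : 0 < |ν| := abs_pos.2 hν
  have hpi := Real.pi_pos
  set ε : ℝ := min 1 (1 / (4 * Real.pi * |ν|)) with hε
  have hε0 : 0 < ε := by positivity
  have hsmall := eventually_coeff_lt hα hφc hC h1 hν
    (fun ε hε => exists_forall_expInt_near_one hGm hG1 hG hε) hε0
  obtain ⟨Cm, hCm, hCm2⟩ := h1
  obtain ⟨J, hJ⟩ := eventually_atTop.1 ((hsmall.and hCm2).and (eventually_ge_atTop 32))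
  have hratio : ∀ q, IsGoodDenom α q → J ≤ q → ‖coeff φ q‖ ≤ ‖q • a‖ ∧
      4 * Real.pi * |ν| * (‖coeff φ q‖ / ‖q • a‖) ≤ 1 := by
    intro q hq hqJ
    have h := ((hJ q hqJ).1.1 hq).le
    have hpos : 0 < ‖q • a‖ := norm_nsmul_pos hα hq.pos.ne'
    constructor
    · refine h.trans (mul_le_of_le_one_left hpos.le (min_le_left _ _))
    · have h2 : ‖coeff φ q‖ / ‖q • a‖ ≤ 1 / (4 * Real.pi * |ν|) := by
        rw [div_le_iff₀ hpos]
        exact h.trans (by gcongr; exact min_le_right _ _)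
      rw [le_div_iff₀ (by positivity)] at h2
      linarith
  have hcs : Summable fun n : ℕ => ‖coeff φ n‖ ^ 2 :=
    ((hasSum_sq_norm_fourierCoeff (memLp_two_ofReal
      (memLp_two_of_continuous hφc))).summable).comp_injective Nat.cast_injective
  have hoff := summable_ratio_off_goodDenom hα hC hcs (fun q hq hqJ => (hratio q hq hqJ).1) hCm
    (fun q hq => (hJ q hq).1.2)
  -- the sparse part of `φ`
  set b : ℕ → ℂ := fun n => if IsGoodDenom α n ∧ J ≤ n then coeff φ n else 0 with hb
  have hble : ∀ n, ‖b n‖ ≤ ‖coeff φ n‖ := fun n => by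
    simp only [hb]; split_ifs <;> simp
  have hbC : ∀ n : ℕ, ‖b n‖ * (n : ℝ) ^ 3 ≤ C := fun n => by
    have := hC n
    rw [Int.cast_natCast, Nat.abs_cast] at this
    exact le_trans (by gcongr; exact hble n) this
  have hb0 : b 0 = 0 := by
    simp only [hb]
    rw [if_neg]
    exact fun h => absurd h.1.pos (lt_irrefl 0)
  have hbs : Summable fun n => ‖b n‖ := by
    refine Summable.of_nonneg_of_le (fun _ => norm_nonneg _) (fun n => ?_)
      ((Real.summable_one_div_nat_pow.2 (by norm_num : 1 < 3)).mul_left C)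
    rcases Nat.eq_zero_or_pos n with rfl | hn
    · rw [hb0]; simp
    · have hn0 : (0 : ℝ) < n := by exact_mod_cast hn
      rw [mul_one_div, le_div_iff₀ (by positivity)]
      exact hbC n
  have hsupp : ∀ n, b n ≠ 0 → IsGoodDenom α n ∧ 32 ≤ n ∧ ‖b n‖ ≤ ‖n • a‖ ∧
      4 * Real.pi * |ν| * (‖b n‖ / ‖n • a‖) ≤ 1 := by
    intro n hn
    have hn' : IsGoodDenom α n ∧ J ≤ n := by
      by_contra h
      exact hn (if_neg h)
    have e : b n = coeff φ n := if_pos hn'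
    rw [e]
    exact ⟨hn'.1, (hJ n hn'.2).2, hratio n hn'.1 hn'.2⟩
  set Φ := waveSeries b with hΦ
  have hΦc : Continuous Φ := continuous_waveSeries hbs
  set f : UnitAddCircle → ℝ := fun x => φ x - Φ x with hf
  have hfc : Continuous f := hφc.sub hΦc
  have hfs : Summable fun m : ℤ => ‖formalCoeff α f m‖ ^ 2 := by
    refine summable_formalCoeff_of_nat (Summable.of_nonneg_of_le (fun _ => by positivity)
      (fun n => ?_) hoff)
    have h1 := norm_formalCoeff_le hα f n
    have h2 : coeff f n = coeff φ n - b n := by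
      rw [hf, coeff_sub hφc hΦc, hΦ, coeff_waveSeries hbs hb0]
    by_cases hn : IsGoodDenom α n ∧ J ≤ n
    · have e : b n = coeff φ n := if_pos hn
      rw [e, sub_self] at h2
      rw [h2, norm_zero, zero_div] at h1
      have : ‖formalCoeff α f n‖ = 0 := le_antisymm h1 (norm_nonneg _)
      rw [this, zero_pow two_ne_zero]
      exact Set.indicator_nonneg (fun _ _ => by positivity) _
    · have e : b n = 0 := if_neg hn
      rw [e, sub_zero] at h2
      rw [h2] at h1
      rw [Set.indicator_of_mem (s := {n | ¬ (IsGoodDenom α n ∧ J ≤ n)}) hn]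
      gcongr
  obtain ⟨ψ, hψm, hψ, hψeq⟩ := exists_coboundary hα (memLp_two_of_continuous hfc) hfs
  set c := (coeff f 0).re
  set G' : UnitAddCircle → ℂ := fun x =>
    Complex.exp (2 * Real.pi * Complex.I * ν * (-ψ x : ℝ)) * G x with hG'
  have hG'm : Measurable G' := by fun_prop
  have hG'1 : ∀ᵐ x, ‖G' x‖ = 1 := by
    filter_upwards [hG1] with x hx
    rw [hG', norm_mul, norm_exp_eq_one, hx, one_mul]
  have hG'eq : ∀ᵐ x, G' (x + a)
      = Complex.exp (2 * Real.pi * Complex.I * ν * ((Φ x + c : ℝ))) * G' x := by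
    filter_upwards [hG, hψeq] with x hx hx2
    have e : Φ x + c = φ x - (ψ (x + a) - ψ x) := by
      rw [hx2, hf]; ring
    simp only [hG']
    rw [hx, e, ← mul_assoc, ← mul_assoc, ← Complex.exp_add, ← Complex.exp_add]
    congr 2
    push_cast
    ring
  obtain ⟨δ, hδ, hKδ⟩ := exists_forall_expInt_near_one hG'm hG'1 hG'eq (half_pos one_pos)
  obtain ⟨g, hg, hgb⟩ := exists_summable_ratio hα hbC hbs hν hsupp hδ (fun N hN => by
    have := hKδ N hN
    have e : bsum a (fun x => Φ x + c) N = fun x => bsum a Φ N x + N * c := by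
      ext x
      simp [bsum, Finset.sum_add_distrib]
    rw [e, norm_expInt_add_const] at this
    norm_num at this ⊢
    exact this)
  refine summable_formalCoeff_of_nat (Summable.of_norm_bounded_eventually_nat (hoff.add hg) ?_)
  filter_upwards [hgb] with n hn
  rw [Real.norm_eq_abs, abs_of_nonneg (by positivity)]
  have h1 := norm_formalCoeff_le hα φ n
  have h2 : ‖formalCoeff α φ n‖ ^ 2 ≤ (‖coeff φ n‖ / ‖n • a‖) ^ 2 := by gcongr
  refine h2.trans ?_
  have hg0 : 0 ≤ g n := le_trans (by positivity) hn
  by_cases hgood : IsGoodDenom α n ∧ J ≤ n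
  · have e : b n = coeff φ n := if_pos hgood
    rw [e] at hn
    have := Set.indicator_nonneg (s := {n | ¬ (IsGoodDenom α n ∧ J ≤ n)})
      (f := fun n : ℕ => (‖coeff φ n‖ / ‖n • a‖) ^ 2) (fun _ _ => by positivity) n
    linarith
  · rw [Set.indicator_of_mem (s := {n | ¬ (IsGoodDenom α n ∧ J ≤ n)}) hgood]
    linarith

/-! ### The identification defining the special flow -/

lemma birkhoff_zero (α : ℝ) (φ : UnitAddCircle → ℝ) (x : UnitAddCircle) : birkhoff α φ 0 x = 0 := by
  change birkhoff α φ (Int.ofNat 0) x = 0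
  simp [birkhoff]

lemma birkhoff_succ (α : ℝ) (φ : UnitAddCircle → ℝ) (n : ℤ) (x : UnitAddCircle) :
    birkhoff α φ (n + 1) x = birkhoff α φ n x + φ (x + n • (α : UnitAddCircle)) := by
  have hs : ∀ m : ℤ, m • (α : UnitAddCircle) = ((m * α : ℝ) : UnitAddCircle) := fun m => by
    rw [← AddCircle.coe_zsmul, zsmul_eq_mul]
  rw [hs]
  cases n with
  | ofNat n =>
    change birkhoff α φ (Int.ofNat (n + 1)) x = _
    simp [birkhoff, Finset.sum_range_succ]
  | negSucc n =>
    have e : ∀ k : ℕ, x + (((Int.negSucc k : ℤ) * α : ℝ) : UnitAddCircle)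
        = x - ((((k : ℝ) + 1) * α : ℝ) : UnitAddCircle) := fun k => by
      rw [sub_eq_add_neg, ← AddCircle.coe_neg, Int.cast_negSucc]
      push_cast
      ring_nf
    rw [e]
    cases n with
    | zero =>
      change birkhoff α φ 0 x = _
      rw [birkhoff_zero]
      simp [birkhoff]
    | succ k =>
      change birkhoff α φ (Int.negSucc k) x = _
      simp only [birkhoff]
      rw [Finset.sum_range_succ _ (k + 1)]
      ring

lemma birkhoff_one (α : ℝ) (φ : UnitAddCircle → ℝ) (x : UnitAddCircle) :
    birkhoff α φ 1 x = φ x := by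
  have := birkhoff_succ α φ 0 x
  simpa [birkhoff_zero] using this

lemma birkhoff_add (α : ℝ) (φ : UnitAddCircle → ℝ) (n m : ℤ) (x : UnitAddCircle) :
    birkhoff α φ (n + m) x = birkhoff α φ n x + birkhoff α φ m (x + n • (α : UnitAddCircle)) := by
  induction m using Int.induction_on with
  | zero => simp [birkhoff_zero]
  | succ m ih =>
    rw [← add_assoc, birkhoff_succ, birkhoff_succ, ih, add_smul]
    abel_nf
  | pred m ih =>
    have h1 := birkhoff_succ α φ (n + (-(m : ℤ) - 1)) x
    have h2 := birkhoff_succ α φ (-(m : ℤ) - 1) (x + n • (α : UnitAddCircle))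
    rw [show n + (-(m : ℤ) - 1) + 1 = n + -(m : ℤ) by ring, ih, add_smul, ← add_assoc] at h1
    rw [show -(m : ℤ) - 1 + 1 = -(m : ℤ) by ring] at h2
    linarith

lemma continuous_birkhoff (α : ℝ) {φ : UnitAddCircle → ℝ} (hφ : Continuous φ) (n : ℤ) :
    Continuous (birkhoff α φ n) := by
  cases n
  · change Continuous fun x => ∑ k ∈ Finset.range _, φ (x + (((k : ℝ) * α : ℝ) : UnitAddCircle))
    fun_prop
  · change Continuous fun x =>
      -∑ k ∈ Finset.range (_ + 1), φ (x - ((((k : ℝ) + 1) * α : ℝ) : UnitAddCircle))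
    fun_prop

/-- The action of `ℤ` on `𝕋 × ℝ` generated by `(x, s) ↦ (x + α, s - φ x)`. -/
def act (α : ℝ) (φ : UnitAddCircle → ℝ) (n : ℤ) (p : UnitAddCircle × ℝ) : UnitAddCircle × ℝ :=
  (p.1 + n • (α : UnitAddCircle), p.2 - birkhoff α φ n p.1)

lemma act_zero (α : ℝ) (φ : UnitAddCircle → ℝ) (p : UnitAddCircle × ℝ) : act α φ 0 p = p := by
  simp [act, birkhoff_zero]

lemma act_act (α : ℝ) (φ : UnitAddCircle → ℝ) (n m : ℤ) (p : UnitAddCircle × ℝ) :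
    act α φ m (act α φ n p) = act α φ (n + m) p := by
  simp only [act, birkhoff_add, add_smul, add_assoc, sub_sub]

lemma proj_eq_act (α : ℝ) (φ : UnitAddCircle → ℝ) (p : UnitAddCircle × ℝ) :
    proj α φ p = act α φ (returnIndex α φ p.1 p.2) p := by
  rw [proj, act, ← AddCircle.coe_zsmul, zsmul_eq_mul]

lemma act_shift (α : ℝ) (φ : UnitAddCircle → ℝ) (n : ℤ) (p : UnitAddCircle × ℝ) (t : ℝ) :
    act α φ n (p.1, p.2 + t) = ((act α φ n p).1, (act α φ n p).2 + t) := by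
  simp only [act]; ring_nf

section Index

variable {α : ℝ} {φ : UnitAddCircle → ℝ}

lemma exists_pos_le (hφ : Continuous φ) (hpos : ∀ x, 0 < φ x) : ∃ ρ > 0, ∀ x, ρ ≤ φ x := by
  obtain ⟨x, -, hx⟩ := isCompact_univ.exists_isMinOn Set.univ_nonempty hφ.continuousOn
  exact ⟨φ x, hpos x, fun y => hx (Set.mem_univ y)⟩

lemma birkhoff_strictMono (hpos : ∀ x, 0 < φ x) (x : UnitAddCircle) :
    StrictMono fun n => birkhoff α φ n x :=
  strictMono_int_of_lt_succ fun n => by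
    rw [birkhoff_succ]; linarith [hpos (x + n • (α : UnitAddCircle))]

lemma birkhoff_sub_ge {ρ : ℝ} (hρ : ∀ x, ρ ≤ φ x) (x : UnitAddCircle) (n : ℤ) (k : ℕ) :
    birkhoff α φ n x + k * ρ ≤ birkhoff α φ (n + k) x := by
  induction k with
  | zero => simp
  | succ k ih =>
    push_cast
    rw [← add_assoc, birkhoff_succ]
    linarith [hρ (x + (n + k) • (α : UnitAddCircle))]

lemma returnIndex_spec (hφ : Continuous φ) (hpos : ∀ x, 0 < φ x) (x : UnitAddCircle) (u : ℝ) :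
    birkhoff α φ (returnIndex α φ x u) x ≤ u ∧ u < birkhoff α φ (returnIndex α φ x u + 1) x := by
  obtain ⟨ρ, hρ0, hρ⟩ := exists_pos_le hφ hpos
  have hmono := birkhoff_strictMono (α := α) hpos x
  set S := {n : ℤ | birkhoff α φ n x ≤ u}
  have hne : S.Nonempty := by
    obtain ⟨k, hk⟩ := exists_nat_ge (-u / ρ)
    rw [div_le_iff₀ hρ0] at hk
    refine ⟨-k, ?_⟩
    have := birkhoff_sub_ge (α := α) hρ x (-k) k
    rw [neg_add_cancel, birkhoff_zero] at this
    change birkhoff α φ (-k) x ≤ u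
    linarith
  have hbdd : BddAbove S := by
    obtain ⟨k, hk⟩ := exists_nat_gt (u / ρ)
    rw [div_lt_iff₀ hρ0] at hk
    refine ⟨k, fun n hn => ?_⟩
    have := birkhoff_sub_ge (α := α) hρ x 0 k
    rw [zero_add, birkhoff_zero] at this
    by_contra! hlt
    have h2 := hmono hlt
    simp only at h2
    have h3 : birkhoff α φ n x ≤ u := hn
    linarith
  refine ⟨Int.csSup_mem hne hbdd, ?_⟩
  by_contra! hle
  have : returnIndex α φ x u + 1 ≤ returnIndex α φ x u := le_csSup hbdd hle
  omega

lemma returnIndex_eq_iff (hφ : Continuous φ) (hpos : ∀ x, 0 < φ x) {x : UnitAddCircle} {u : ℝ}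
    {n : ℤ} : returnIndex α φ x u = n ↔ birkhoff α φ n x ≤ u ∧ u < birkhoff α φ (n + 1) x := by
  constructor
  · rintro rfl
    exact returnIndex_spec hφ hpos x u
  · rintro ⟨h1, h2⟩
    obtain ⟨h3, h4⟩ := returnIndex_spec (α := α) hφ hpos x u
    have hmono := birkhoff_strictMono (α := α) hpos x
    have k1 := hmono.lt_iff_lt.1 (h1.trans_lt h4)
    have k2 := hmono.lt_iff_lt.1 (h3.trans_lt h2)
    omega

lemma act_mem_region_iff (hφ : Continuous φ) (hpos : ∀ x, 0 < φ x) {p : UnitAddCircle × ℝ} {n : ℤ} :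
    act α φ n p ∈ region φ ↔ returnIndex α φ p.1 p.2 = n := by
  rw [returnIndex_eq_iff hφ hpos, birkhoff_succ]
  simp only [region, act, Set.mem_ofPred_eq, sub_nonneg, sub_lt_iff_lt_add']

lemma proj_mem_region (hφ : Continuous φ) (hpos : ∀ x, 0 < φ x) (p : UnitAddCircle × ℝ) :
    proj α φ p ∈ region φ := by
  rw [proj_eq_act, act_mem_region_iff hφ hpos]

lemma proj_eq_of_act_mem (hφ : Continuous φ) (hpos : ∀ x, 0 < φ x) {p : UnitAddCircle × ℝ} {n : ℤ}
    (h : act α φ n p ∈ region φ) : proj α φ p = act α φ n p := by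
  rw [proj_eq_act, (act_mem_region_iff hφ hpos).1 h]

lemma proj_of_mem (hφ : Continuous φ) (hpos : ∀ x, 0 < φ x) {p : UnitAddCircle × ℝ}
    (h : p ∈ region φ) : proj α φ p = p := by
  have := proj_eq_of_act_mem (α := α) (n := 0) hφ hpos (p := p) (by rwa [act_zero])
  rwa [act_zero] at this

lemma proj_act (hφ : Continuous φ) (hpos : ∀ x, 0 < φ x) (n : ℤ) (p : UnitAddCircle × ℝ) :
    proj α φ (act α φ n p) = proj α φ p := by
  have h : act α φ (returnIndex α φ p.1 p.2 - n) (act α φ n p) ∈ region φ := by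
    rw [act_act, add_sub_cancel, ← proj_eq_act]
    exact proj_mem_region hφ hpos p
  rw [proj_eq_of_act_mem hφ hpos h, act_act, add_sub_cancel, ← proj_eq_act]

lemma proj_proj_shift (hφ : Continuous φ) (hpos : ∀ x, 0 < φ x) (p : UnitAddCircle × ℝ) (t : ℝ) :
    proj α φ ((proj α φ p).1, (proj α φ p).2 + t) = proj α φ (p.1, p.2 + t) := by
  rw [proj_eq_act α φ p, ← act_shift, proj_act hφ hpos]

lemma measurable_act (hφ : Continuous φ) (n : ℤ) : Measurable (act α φ n) := by
  have := continuous_birkhoff α hφ n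
  unfold act
  fun_prop

lemma measurableSet_region (hφ : Continuous φ) : MeasurableSet (region φ) := by
  have := hφ.measurable
  exact (measurableSet_le measurable_const measurable_snd).inter
    (measurableSet_lt measurable_snd (this.comp measurable_fst))

lemma measurable_returnIndex (hφ : Continuous φ) (hpos : ∀ x, 0 < φ x) :
    Measurable fun p : UnitAddCircle × ℝ => returnIndex α φ p.1 p.2 := by
  refine measurable_to_countable' fun n => ?_
  have : (fun p : UnitAddCircle × ℝ => returnIndex α φ p.1 p.2) ⁻¹' {n}
      = act α φ n ⁻¹' region φ := by
    ext p
    rw [Set.mem_preimage, Set.mem_preimage, act_mem_region_iff hφ hpos, Set.mem_singleton_iff]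
  rw [this]
  exact measurable_act hφ n (measurableSet_region hφ)

lemma measurable_proj (hφ : Continuous φ) (hpos : ∀ x, 0 < φ x) : Measurable (proj α φ) := by
  have h : Measurable fun q : ℤ × (UnitAddCircle × ℝ) => act α φ q.1 q.2 :=
    measurable_from_prod_countable_right fun n => measurable_act hφ n
  have e : proj α φ = fun p => (fun q : ℤ × (UnitAddCircle × ℝ) => act α φ q.1 q.2)
      (returnIndex α φ p.1 p.2, p) := funext fun p => proj_eq_act α φ p
  rw [e]
  exact h.comp ((measurable_returnIndex hφ hpos).prodMk measurable_id)

lemma measurePreserving_skew (a : UnitAddCircle) {h : UnitAddCircle → ℝ} (hh : Measurable h) :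
    MeasurePreserving (fun p : UnitAddCircle × ℝ => (p.1 + a, p.2 + h p.1)) volume volume := by
  refine (measurePreserving_rotation a).skew_product (g := fun x s => s + h x) ?_
    (Eventually.of_forall fun x => ?_)
  · exact measurable_snd.add (hh.comp measurable_fst)
  · exact (measurePreserving_add_right volume (h x)).map_eq

lemma measurePreserving_act (hφ : Continuous φ) (n : ℤ) :
    MeasurePreserving (act α φ n) volume volume :=
  measurePreserving_skew (n • (α : UnitAddCircle)) (continuous_birkhoff α hφ n).neg.measurable

lemma measurePreserving_shear {ψ : UnitAddCircle → ℝ} (hψ : Measurable ψ) :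
    MeasurePreserving (fun p : UnitAddCircle × ℝ => (p.1, p.2 + ψ p.1)) volume volume := by
  simpa using measurePreserving_skew 0 hψ

/-- The additive action defined by `act`. -/
@[reducible] def flowAction (α : ℝ) (φ : UnitAddCircle → ℝ) : AddAction ℤ (UnitAddCircle × ℝ) where
  vadd := act α φ
  zero_vadd := act_zero α φ
  add_vadd n m p := by
    change act α φ (n + m) p = act α φ n (act α φ m p)
    rw [act_act, add_comm]

end Index

/-! ### Cohomologous roof functions -/

lemma ae_forall_translate {P : UnitAddCircle → Prop} (a : UnitAddCircle) (h : ∀ᵐ x, P x) :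
    ∀ᵐ x, ∀ n : ℤ, P (x + n • a) := by
  rw [ae_all_iff]
  intro n
  exact (measurePreserving_rotation (n • a)).quasiMeasurePreserving.ae h

lemma ae_forall_birkhoff {α : ℝ} {φ₁ φ₂ ψ : UnitAddCircle → ℝ}
    (h : ∀ᵐ x, ψ (x + (α : UnitAddCircle)) - ψ x = φ₁ x - φ₂ x) :
    ∀ᵐ x, ∀ n : ℤ, ψ (x + n • (α : UnitAddCircle)) - ψ x
      = birkhoff α φ₁ n x - birkhoff α φ₂ n x := by
  filter_upwards [ae_forall_translate (α : UnitAddCircle) h] with x hx n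
  induction n using Int.induction_on with
  | zero => simp [birkhoff_zero]
  | succ n ih =>
    have := hx n
    rw [birkhoff_succ, birkhoff_succ, add_smul, one_smul, ← add_assoc]
    linarith
  | pred n ih =>
    have := hx (-(n : ℤ) - 1)
    have e1 := birkhoff_succ α φ₁ (-(n : ℤ) - 1) x
    have e2 := birkhoff_succ α φ₂ (-(n : ℤ) - 1) x
    rw [show -(n : ℤ) - 1 + 1 = -(n : ℤ) by ring] at e1 e2
    have e3 : x + (-(n : ℤ) - 1) • (α : UnitAddCircle) + (α : UnitAddCircle)
        = x + (-(n : ℤ)) • (α : UnitAddCircle) := by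
      rw [sub_smul, one_smul]; abel
    rw [e3] at this
    linarith

lemma ae_shear_act {α : ℝ} {φ₁ φ₂ ψ : UnitAddCircle → ℝ}
    (h : ∀ᵐ x, ψ (x + (α : UnitAddCircle)) - ψ x = φ₁ x - φ₂ x) :
    ∀ᵐ x, ∀ (n : ℤ) (s : ℝ), (fun p : UnitAddCircle × ℝ => (p.1, p.2 + ψ p.1)) (act α φ₁ n (x, s))
      = act α φ₂ n (x, s + ψ x) := by
  filter_upwards [ae_forall_birkhoff h] with x hx n s
  have := hx n
  simp only [act, Prod.mk.injEq, true_and]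
  linarith

lemma isAddFundamentalDomain_shear {α : ℝ} {φ₁ φ₂ ψ : UnitAddCircle → ℝ}
    (hφ₁ : Continuous φ₁) (hpos₁ : ∀ x, 0 < φ₁ x) (hψ : Measurable ψ)
    (h : ∀ᵐ x, ψ (x + (α : UnitAddCircle)) - ψ x = φ₁ x - φ₂ x) :
    letI := flowAction α φ₂
    IsAddFundamentalDomain ℤ {p : UnitAddCircle × ℝ | (p.1, p.2 - ψ p.1) ∈ region φ₁} volume := by
  let := flowAction α φ₂
  set D := {p : UnitAddCircle × ℝ | (p.1, p.2 - ψ p.1) ∈ region φ₁} with hD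
  have hDm : MeasurableSet D := by
    have : Measurable fun p : UnitAddCircle × ℝ => (p.1, p.2 - ψ p.1) := by fun_prop
    exact this (measurableSet_region hφ₁)
  have hgood : ∀ᵐ p : UnitAddCircle × ℝ, ∀ n : ℤ,
      act α φ₂ n p ∈ D ↔ returnIndex α φ₁ p.1 (p.2 - ψ p.1) = n := by
    have := Measure.quasiMeasurePreserving_fst (μ := (volume : Measure UnitAddCircle))
      (ν := (volume : Measure ℝ)).ae (ae_shear_act h)
    filter_upwards [this] with p hp n
    have e := hp n (p.2 - ψ p.1)
    rw [sub_add_cancel] at e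
    rw [← act_mem_region_iff (p := (p.1, p.2 - ψ p.1)) hφ₁ hpos₁, hD, Set.mem_ofPred_eq,
      show act α φ₂ n p = act α φ₂ n (p.1, p.2) from rfl, ← e]
    simp
  refine ⟨hDm.nullMeasurableSet, ?_, ?_⟩
  · filter_upwards [hgood] with p hp
    exact ⟨_, (hp _).2 rfl⟩
  · intro n m hnm
    refine measure_mono_null (fun p hp => ?_) hgood
    intro hp2
    obtain ⟨⟨d, hd, hd2⟩, ⟨e, he, he2⟩⟩ := hp
    have key : ∀ (k : ℤ) (d : UnitAddCircle × ℝ), d ∈ D → act α φ₂ k d = p →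
        returnIndex α φ₁ p.1 (p.2 - ψ p.1) = -k := by
      intro k d hd hk
      rw [← hp2, ← hk, act_act, add_neg_cancel, act_zero]
      exact hd
    have k1 := key n d hd hd2
    have k2 := key m e he he2
    exact hnm (by omega)

/-- A coboundary displacement preserves the measures of the special flows. -/
lemma measurePreserving_proj_shear {α : ℝ} {φ₁ φ₂ ψ : UnitAddCircle → ℝ}
    (hφ₁ : Continuous φ₁) (hpos₁ : ∀ x, 0 < φ₁ x) (hφ₂ : Continuous φ₂) (hpos₂ : ∀ x, 0 < φ₂ x)
    (hψ : Measurable ψ) (h : ∀ᵐ x, ψ (x + (α : UnitAddCircle)) - ψ x = φ₁ x - φ₂ x) :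
    MeasurePreserving (fun p : UnitAddCircle × ℝ => proj α φ₂ (p.1, p.2 + ψ p.1))
      (flowMeasure φ₁) (flowMeasure φ₂) := by
  let := flowAction α φ₂
  have hD₁ := isAddFundamentalDomain_shear hφ₁ hpos₁ hψ h
  have hD₂ := isAddFundamentalDomain_shear (α := α) (φ₁ := φ₂) (φ₂ := φ₂) (ψ := fun _ => 0)
    hφ₂ hpos₂ measurable_const (Eventually.of_forall fun x => by simp)
  simp only [sub_zero] at hD₂
  have : MeasurableConstVAdd ℤ (UnitAddCircle × ℝ) := ⟨fun n => measurable_act hφ₂ n⟩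
  have : VAddInvariantMeasure ℤ (UnitAddCircle × ℝ) volume :=
    ⟨fun n s hs => (measurePreserving_act hφ₂ n).measure_preimage hs.nullMeasurableSet⟩
  have hsh := measurePreserving_shear hψ
  have hmeas : Measurable (fun p : UnitAddCircle × ℝ => proj α φ₂ (p.1, p.2 + ψ p.1)) :=
    (measurable_proj hφ₂ hpos₂).comp hsh.measurable
  refine ⟨hmeas, Measure.ext fun A hA => ?_⟩
  rw [Measure.map_apply hmeas hA, flowMeasure, flowMeasure, Measure.restrict_apply (hmeas hA),
    Measure.restrict_apply hA]
  have hpA : MeasurableSet (proj α φ₂ ⁻¹' A) := measurable_proj hφ₂ hpos₂ hA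
  have hinv : ∀ n : ℤ, (fun p : UnitAddCircle × ℝ => n +ᵥ p) ⁻¹' (proj α φ₂ ⁻¹' A)
      = proj α φ₂ ⁻¹' A := by
    intro n
    ext p
    change proj α φ₂ (act α φ₂ n p) ∈ A ↔ _
    rw [proj_act hφ₂ hpos₂]
    rfl
  have key := hD₁.measure_set_eq hD₂ hpA hinv
  have e2 : proj α φ₂ ⁻¹' A ∩ {p : UnitAddCircle × ℝ | (p.1, p.2) ∈ region φ₂}
      = A ∩ region φ₂ := by
    ext p
    simp only [Set.mem_inter_iff, Set.mem_preimage, Set.mem_ofPred_eq, Prod.mk.eta]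
    constructor
    · rintro ⟨h1, h2⟩; rw [proj_of_mem hφ₂ hpos₂ h2] at h1; exact ⟨h1, h2⟩
    · rintro ⟨h1, h2⟩; rw [proj_of_mem hφ₂ hpos₂ h2]; exact ⟨h1, h2⟩
  rw [e2] at key
  rw [← key, ← hsh.measure_preimage (hpA.nullMeasurableSet.inter hD₁.nullMeasurableSet)]
  congr 1
  ext p
  simp

lemma ae_flowMeasure_of_ae {φ : UnitAddCircle → ℝ} {P : UnitAddCircle → Prop} (h : ∀ᵐ x, P x) :
    ∀ᵐ p ∂(flowMeasure φ), P p.1 :=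
  ae_restrict_of_ae (Measure.quasiMeasurePreserving_fst (μ := (volume : Measure UnitAddCircle))
      (ν := (volume : Measure ℝ)).ae h)

lemma ae_mem_region {φ : UnitAddCircle → ℝ} (hφ : Continuous φ) :
    ∀ᵐ p ∂(flowMeasure φ), p ∈ region φ :=
  ae_restrict_mem (measurableSet_region hφ)

lemma measurePreserving_flow {α : ℝ} {φ : UnitAddCircle → ℝ} (hφ : Continuous φ)
    (hpos : ∀ x, 0 < φ x) (t : ℝ) :
    MeasurePreserving (flow α φ t) (flowMeasure φ) (flowMeasure φ) :=
  measurePreserving_proj_shear (ψ := fun _ => t) hφ hpos hφ hpos measurable_const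
    (Eventually.of_forall fun x => by simp)

lemma ae_proj_shear_inverse {α : ℝ} {φ₁ φ₂ ψ : UnitAddCircle → ℝ} (hφ₁ : Continuous φ₁)
    (hpos₁ : ∀ x, 0 < φ₁ x) (h : ∀ᵐ x, ψ (x + (α : UnitAddCircle)) - ψ x = φ₁ x - φ₂ x) :
    ∀ᵐ p ∂(flowMeasure φ₁), proj α φ₁ ((proj α φ₂ (p.1, p.2 + ψ p.1)).1,
      (proj α φ₂ (p.1, p.2 + ψ p.1)).2 - ψ (proj α φ₂ (p.1, p.2 + ψ p.1)).1) = p := by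
  filter_upwards [ae_flowMeasure_of_ae (ae_shear_act h), ae_mem_region hφ₁] with p hp hmem
  have e := hp (returnIndex α φ₂ p.1 (p.2 + ψ p.1)) p.2
  rw [proj_eq_act α φ₂, ← e]
  simp only [add_sub_cancel_right]
  exact (proj_act hφ₁ hpos₁ _ _).trans (proj_of_mem hφ₁ hpos₁ hmem)

lemma ae_proj_shear_flow {α : ℝ} {φ₁ φ₂ ψ : UnitAddCircle → ℝ} (hφ₂ : Continuous φ₂)
    (hpos₂ : ∀ x, 0 < φ₂ x) (h : ∀ᵐ x, ψ (x + (α : UnitAddCircle)) - ψ x = φ₁ x - φ₂ x) (t : ℝ) :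
    ∀ᵐ p ∂(flowMeasure φ₁),
      proj α φ₂ ((flow α φ₁ t p).1, (flow α φ₁ t p).2 + ψ (flow α φ₁ t p).1)
        = flow α φ₂ t (proj α φ₂ (p.1, p.2 + ψ p.1)) := by
  filter_upwards [ae_flowMeasure_of_ae (ae_shear_act h)] with p hp
  have e := hp (returnIndex α φ₁ p.1 (p.2 + t)) (p.2 + t)
  rw [flow, flow, proj_eq_act α φ₁, e, proj_act hφ₂ hpos₂, proj_proj_shift hφ₂ hpos₂]
  congr 2
  ring

/-- Special flows under `L²`-cohomologous functions are `L²`-conjugate. -/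
lemma l2Conjugate_of_coboundary {α : ℝ} {φ₁ φ₂ ψ : UnitAddCircle → ℝ}
    (hφ₁ : Continuous φ₁) (hpos₁ : ∀ x, 0 < φ₁ x) (hφ₂ : Continuous φ₂) (hpos₂ : ∀ x, 0 < φ₂ x)
    (hψ : Measurable ψ) (hψ2 : MemLp ψ 2 volume)
    (h : ∀ᵐ x, ψ (x + (α : UnitAddCircle)) - ψ x = φ₁ x - φ₂ x) : L2Conjugate α φ₁ φ₂ := by
  have hneg : ∀ᵐ x, (-ψ) (x + (α : UnitAddCircle)) - (-ψ) x = φ₂ x - φ₁ x := by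
    filter_upwards [h] with x hx
    rw [Pi.neg_apply, Pi.neg_apply]
    linarith
  refine ⟨fun p => proj α φ₂ (p.1, p.2 + ψ p.1), ψ,
    ⟨measurePreserving_proj_shear hφ₁ hpos₁ hφ₂ hpos₂ hψ h,
      ⟨fun p => proj α φ₁ (p.1, p.2 - ψ p.1), ?_, ?_, ?_⟩, ?_⟩,
    hψ2, Eventually.of_forall fun _ => rfl⟩
  · simpa only [← sub_eq_add_neg, Pi.neg_apply] using
      measurePreserving_proj_shear hφ₂ hpos₂ hφ₁ hpos₁ hψ.neg hneg
  · exact ae_proj_shear_inverse hφ₁ hpos₁ h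
  · simpa only [Pi.neg_apply, sub_neg_eq_add, ← sub_eq_add_neg] using
      ae_proj_shear_inverse hφ₂ hpos₂ hneg
  · exact ae_proj_shear_flow hφ₂ hpos₂ h

/-! ### Conjugacy to a suspension flow -/

lemma birkhoff_const (α c : ℝ) (n : ℤ) (x : UnitAddCircle) :
    birkhoff α (fun _ => c) n x = n * c := by
  induction n using Int.induction_on with
  | zero => simp [birkhoff_zero]
  | succ n ih => rw [birkhoff_succ, ih]; push_cast; ring
  | pred n ih =>
    have e := birkhoff_succ α (fun _ => c) (-(n : ℤ) - 1) x
    rw [show -(n : ℤ) - 1 + 1 = -(n : ℤ) by ring, ih] at e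
    push_cast at e ⊢
    linarith

lemma zsmul_injective {α : ℝ} (hα : Irrational α) {n m : ℤ}
    (h : n • (α : UnitAddCircle) = m • (α : UnitAddCircle)) : n = m := by
  by_contra hne
  have := norm_zsmul_pos hα (sub_ne_zero.2 hne)
  rw [sub_smul, h, sub_self, norm_zero] at this
  exact this.false

lemma proj_const_eq {α : ℝ} (hα : Irrational α) {c : ℝ} {x : UnitAddCircle} {u v : ℝ}
    (h : proj α (fun _ => c) (x + (α : UnitAddCircle), u) = proj α (fun _ => c) (x, v)) :
    u = v - c := by
  rw [proj_eq_act, proj_eq_act, act, act, birkhoff_const, birkhoff_const, Prod.mk.injEq] at h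
  generalize returnIndex α (fun _ => c) (x + (α : UnitAddCircle), u).1
    (x + (α : UnitAddCircle), u).2 = n at h
  generalize returnIndex α (fun _ => c) (x, v).1 (x, v).2 = m at h
  obtain ⟨h1, h2⟩ := h
  simp only at h1 h2
  have h3 : (1 + n) • (α : UnitAddCircle) = m • (α : UnitAddCircle) := by
    rw [add_smul, one_smul]
    rw [add_assoc] at h1
    exact add_left_cancel h1
  have h4 := zsmul_injective hα h3
  rw [← h4] at h2
  push_cast at h2
  linarith

lemma flow_eq_of_cross {α : ℝ} {φ : UnitAddCircle → ℝ} (hφ : Continuous φ) (hpos : ∀ x, 0 < φ x)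
    {x : UnitAddCircle} {s t : ℝ} (h1 : φ x ≤ s + t)
    (h2 : s + t < φ x + φ (x + (α : UnitAddCircle))) :
    flow α φ t (x, s) = (x + (α : UnitAddCircle), s + t - φ x) := by
  have e : act α φ 1 (x, s + t) = (x + (α : UnitAddCircle), s + t - φ x) := by
    simp [act, birkhoff_one]
  rw [flow, ← e]
  apply proj_eq_of_act_mem hφ hpos
  rw [e]
  exact ⟨by simpa using h1, by simp only; linarith⟩

/-- The displacement in an `L²` conjugacy to a suspension solves the cohomological equation. -/
lemma ae_coboundary_of_conjugacy {α : ℝ} (hα : Irrational α) {φ : UnitAddCircle → ℝ}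
    (hφ : Continuous φ) (hpos : ∀ x, 0 < φ x) {c : ℝ} (hc : 0 < c)
    {h : UnitAddCircle × ℝ → UnitAddCircle × ℝ} {ψ : UnitAddCircle → ℝ}
    (hconj : IsConjugacy (flow α φ) (flowMeasure φ) (flow α fun _ => c) (flowMeasure fun _ => c) h)
    (hψ : ∀ᵐ p ∂(flowMeasure φ), h p = proj α (fun _ => c) (p.1, p.2 + ψ p.1)) :
    ∀ᵐ x, ψ (x + (α : UnitAddCircle)) - ψ x = φ x - c := by
  obtain ⟨ρ, hρ, hρφ⟩ := exists_pos_le hφ hpos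
  have h1 := hconj.2.2 ρ
  have h2 := (measurePreserving_flow (α := α) hφ hpos ρ).quasiMeasurePreserving.ae hψ
  have h3 : ∀ᵐ p ∂(flowMeasure φ), φ p.1 ≤ p.2 + ρ →
      ψ (p.1 + (α : UnitAddCircle)) - ψ p.1 = φ p.1 - c := by
    filter_upwards [h1, h2, hψ, ae_mem_region hφ] with p k1 k2 k3 k4 hle
    have hf : flow α φ ρ p = (p.1 + (α : UnitAddCircle), p.2 + ρ - φ p.1) :=
      flow_eq_of_cross hφ hpos hle (by linarith [hρφ (p.1 + (α : UnitAddCircle)), k4.2])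
    rw [k2, k3, hf, flow, proj_proj_shift continuous_const (fun _ => hc)] at k1
    have := proj_const_eq hα k1
    simp only at this
    linarith
  rw [flowMeasure, ae_restrict_iff' (measurableSet_region hφ)] at h3
  have h4 := Measure.ae_ae_of_ae_prod h3
  filter_upwards [h4] with x hx
  by_contra hne
  have h5 : ∀ᵐ s : ℝ, s ∉ Set.Ico (φ x - ρ) (φ x) := by
    filter_upwards [hx] with s hs hmem
    exact hne (hs ⟨by simp only; linarith [hρφ x, hmem.1], hmem.2⟩ (by linarith [hmem.1]))
  have h6 := measure_eq_zero_iff_ae_notMem.2 h5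
  rw [Real.volume_Ico] at h6
  simp at h6
  linarith

theorem summable_of_l2ConjugateToSuspension {α : ℝ} (hα : Irrational α) {φ : UnitAddCircle → ℝ}
    (hφ : Continuous φ) (hpos : ∀ x, 0 < φ x) (h : L2ConjugateToSuspension α φ) :
    Summable fun m : ℤ => ‖formalCoeff α φ m‖ ^ 2 := by
  obtain ⟨c, hc, h, ψ, hconj, hψ2, hψ⟩ := h
  exact summable_of_coboundary hα (memLp_two_of_continuous hφ) hψ2
    (ae_coboundary_of_conjugacy hα hφ hpos hc hconj hψ)

lemma coeff_zero_re_pos {φ : UnitAddCircle → ℝ} (hφ : Continuous φ) (hpos : ∀ x, 0 < φ x) :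
    0 < (coeff φ 0).re := by
  obtain ⟨ρ, hρ, hρφ⟩ := exists_pos_le hφ hpos
  have e : coeff φ 0 = ((∫ x, φ x : ℝ) : ℂ) := by
    rw [coeff, fourierCoeff_eq, ← integral_complex_ofReal]
    simp
  rw [e, Complex.ofReal_re]
  have := integral_mono (integrable_const ρ) (integrable_of_continuous hφ) hρφ
  simp only [integral_const, probReal_univ, one_smul] at this
  linarith

theorem l2ConjugateToSuspension_of_summable {α : ℝ} (hα : Irrational α) {φ : UnitAddCircle → ℝ}
    (hφ : Continuous φ) (hpos : ∀ x, 0 < φ x)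
    (h : Summable fun m : ℤ => ‖formalCoeff α φ m‖ ^ 2) : L2ConjugateToSuspension α φ := by
  obtain ⟨ψ, hψm, hψ2, hψ⟩ := exists_coboundary hα (memLp_two_of_continuous hφ) h
  have hc := coeff_zero_re_pos hφ hpos
  exact ⟨_, hc, l2Conjugate_of_coboundary hφ hpos continuous_const (fun _ => hc) hψm hψ2 hψ⟩

/-! ### Suspension flows are not weak mixing -/

lemma isFiniteMeasure_flowMeasure_const (c : ℝ) : IsFiniteMeasure (flowMeasure fun _ => c) := by
  refine ⟨?_⟩
  rw [flowMeasure, Measure.restrict_apply_univ]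
  have : region (fun _ => c) ⊆ Set.univ ×ˢ Set.Ico 0 c := fun p hp => ⟨trivial, hp⟩
  refine (measure_mono this).trans_lt ?_
  rw [Measure.volume_eq_prod, Measure.prod_prod, UnitAddCircle.measure_univ, Real.volume_Ico]
  simp

theorem not_weakMixing_of_isConjugacy {X : Type*} [MeasurableSpace X] {T : ℝ → X → X}
    {μ : Measure X} {α c : ℝ} (hc : 0 < c) {h : X → UnitAddCircle × ℝ}
    (hconj : IsConjugacy T μ (flow α fun _ => c) (flowMeasure fun _ => c) h) :
    ¬ WeakMixing T μ := by
  intro hwm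
  have hc' : (c : ℂ) ≠ 0 := by exact_mod_cast hc.ne'
  set f : UnitAddCircle × ℝ → ℂ := fun q => Complex.exp (2 * Real.pi * Complex.I * (1 / c : ℝ) * q.2)
    with hf
  have hfc : Continuous f := by fun_prop
  have hfin := isFiniteMeasure_flowMeasure_const c
  have hfL : MemLp f 2 (flowMeasure fun _ => c) :=
    MemLp.of_bound hfc.aestronglyMeasurable 1
      (Eventually.of_forall fun q => (norm_exp_eq_one _ _).le)
  have hflow : ∀ t q, f (flow α (fun _ => c) t q)
      = Complex.exp (2 * Real.pi * Complex.I * (1 / c : ℝ) * t) * f q := by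
    intro t q
    rw [flow, proj_eq_act, act, birkhoff_const]
    generalize returnIndex α (fun _ => c) (q.1, q.2 + t).1 (q.1, q.2 + t).2 = n
    simp only [hf]
    rw [← Complex.exp_add, Complex.exp_eq_exp_iff_exists_int]
    refine ⟨-n, ?_⟩
    push_cast
    field_simp
    ring
  obtain ⟨k, hk⟩ := hwm (1 / c) (f ∘ h) (hfL.comp_measurePreserving hconj.1) (fun t => by
    filter_upwards [hconj.2.2 t] with p hp
    rw [Function.comp, hp, hflow]
    rfl)
  have hk2 : ∀ᵐ q ∂(flowMeasure fun _ => c), f q = k := by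
    rw [← hconj.1.map_eq]
    exact (ae_map_iff hconj.1.aemeasurable
      (hfc.measurable (measurableSet_singleton k))).2 hk
  set U : Set (UnitAddCircle × ℝ) := Set.univ ×ˢ Set.Ioo 0 c with hU
  have hUo : IsOpen U := isOpen_univ.prod isOpen_Ioo
  have hUr : U ⊆ region fun _ => c := fun q hq => ⟨hq.2.1.le, hq.2.2⟩
  have hk3 : f =ᵐ[volume.restrict U] fun _ => k := ae_restrict_of_ae_restrict_of_subset hUr hk2
  have heq := Measure.eqOn_open_of_ae_eq hk3 hUo hfc.continuousOn continuousOn_const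
  have v1 := heq (x := (0, c / 2)) ⟨trivial, by simp only; constructor <;> linarith⟩
  have v2 := heq (x := (0, c / 4)) ⟨trivial, by simp only; constructor <;> linarith⟩
  have e1 : f (0, c / 2) = -1 := by
    simp only [hf]
    rw [← Complex.exp_pi_mul_I]
    congr 1
    push_cast
    field_simp
  have e2 : f (0, c / 4) = Complex.I := by
    refine Eq.trans (congrArg Complex.exp ?_) Complex.exp_pi_div_two_mul_I
    push_cast
    field_simp
    norm_num
  have : (-1 : ℂ) = Complex.I := by rw [← e1, ← e2, v1, v2]
  have := congrArg Complex.re this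
  simp at this

/-! ### Eigenfunctions of special flows -/

lemma ae_of_ae_region {α : ℝ} {φ : UnitAddCircle → ℝ} (hφ : Continuous φ) (hpos : ∀ x, 0 < φ x)
    {P : UnitAddCircle × ℝ → Prop} (hinv : ∀ n p, P (act α φ n p) ↔ P p)
    (h : ∀ᵐ p ∂(flowMeasure φ), P p) : ∀ᵐ p, P p := by
  let := flowAction α φ
  have hD := isAddFundamentalDomain_shear (α := α) (φ₁ := φ) (φ₂ := φ) (ψ := fun _ => 0)
    hφ hpos measurable_const (Eventually.of_forall fun x => by simp)
  simp only [sub_zero] at hD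
  have : MeasurableConstVAdd ℤ (UnitAddCircle × ℝ) := ⟨fun n => measurable_act hφ n⟩
  have : VAddInvariantMeasure ℤ (UnitAddCircle × ℝ) volume :=
    ⟨fun n s hs => (measurePreserving_act hφ n).measure_preimage hs.nullMeasurableSet⟩
  refine hD.measure_zero_of_invariant {p | ¬ P p} (fun n => ?_) ?_
  · ext p
    rw [Set.mem_vadd_set_iff_neg_vadd_mem]
    exact not_congr (hinv (-n) p)
  · rw [flowMeasure, ae_iff, Measure.restrict_apply' (measurableSet_region hφ)] at h
    exact h

/-- An `L²` eigenfunction of a special flow comes from a solution of the multiplicative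
cohomological equation. -/
lemma exists_cocycle_of_eigenfunction {α : ℝ} {φ : UnitAddCircle → ℝ} (hφ : Continuous φ)
    (hpos : ∀ x, 0 < φ x) {ν : ℝ} {f : UnitAddCircle × ℝ → ℂ}
    (hf : AEStronglyMeasurable f (flowMeasure φ))
    (hfe : ∀ t : ℝ, ∀ᵐ p ∂(flowMeasure φ),
      f (flow α φ t p) = Complex.exp (2 * Real.pi * Complex.I * ν * t) * f p) :
    ∃ G : UnitAddCircle → ℂ, Measurable G ∧
      (∀ᵐ x, G (x + (α : UnitAddCircle)) = Complex.exp (2 * Real.pi * Complex.I * ν * φ x) * G x) ∧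
      ∀ᵐ p ∂(flowMeasure φ), f p = Complex.exp (2 * Real.pi * Complex.I * ν * p.2) * G p.1 := by
  set f' := hf.mk f with hf'
  have hf'm : Measurable f' := hf.stronglyMeasurable_mk.measurable
  have hff' : f =ᵐ[flowMeasure φ] f' := hf.ae_eq_mk
  set F : UnitAddCircle × ℝ → ℂ := fun p => f' (proj α φ p) with hF
  have hFm : Measurable F := hf'm.comp (measurable_proj hφ hpos)
  have hFinv : ∀ n p, F (act α φ n p) = F p := fun n p => by simp only [hF, proj_act hφ hpos]
  have hFflow : ∀ t : ℝ, ∀ᵐ p : UnitAddCircle × ℝ,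
      F (p.1, p.2 + t) = Complex.exp (2 * Real.pi * Complex.I * ν * t) * F p := by
    intro t
    refine ae_of_ae_region (α := α) hφ hpos (fun n p => ?_) ?_
    · rw [hFinv, ← act_shift, hFinv]
    · filter_upwards [hfe t, hff', ae_mem_region hφ,
        (measurePreserving_flow (α := α) hφ hpos t).quasiMeasurePreserving.ae hff'] with p h1 h2 h3 h4
      rw [h4, h2] at h1
      simp only [hF]
      rw [proj_of_mem hφ hpos h3]
      exact h1
  set g : UnitAddCircle × ℝ → ℂ := fun p =>
    Complex.exp (2 * Real.pi * Complex.I * ν * (-p.2 : ℝ)) * F p with hg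
  have hgm : Measurable g := by
    have : Measurable fun p : UnitAddCircle × ℝ =>
        Complex.exp (2 * Real.pi * Complex.I * ν * (-p.2 : ℝ)) :=
      Continuous.measurable (by fun_prop)
    exact this.mul hFm
  have hFg : ∀ p, F p = Complex.exp (2 * Real.pi * Complex.I * ν * p.2) * g p := by
    intro p
    simp only [hg]
    rw [← mul_assoc, ← Complex.exp_add]
    push_cast
    rw [mul_neg, add_neg_cancel, Complex.exp_zero, one_mul]
  have hgt : ∀ᵐ t : ℝ, ∀ᵐ p : UnitAddCircle × ℝ, g (p.1, p.2 + t) = g p := by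
    refine Eventually.of_forall fun t => ?_
    filter_upwards [hFflow t] with p hp
    simp only [hg]
    rw [hp, ← mul_assoc, ← Complex.exp_add]
    congr 2
    push_cast
    ring
  have hset : MeasurableSet {q : ℝ × (UnitAddCircle × ℝ) | g (q.2.1, q.2.2 + q.1) = g q.2} := by
    refine measurableSet_eq_fun (hgm.comp ?_) (hgm.comp measurable_snd)
    fun_prop
  have hgp : ∀ᵐ p : UnitAddCircle × ℝ, ∀ᵐ t : ℝ, g (p.1, p.2 + t) = g p :=
    (Measure.ae_ae_comm hset).1 hgt
  have hgx : ∀ᵐ x : UnitAddCircle, ∃ k : ℂ, ∀ᵐ u : ℝ, g (x, u) = k := by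
    filter_upwards [Measure.ae_ae_of_ae_prod hgp] with x hx
    obtain ⟨s, hs⟩ := hx.exists
    refine ⟨g (x, s), ?_⟩
    have := (measurePreserving_add_right (volume : Measure ℝ) (-s)).quasiMeasurePreserving.ae hs
    filter_upwards [this] with u hu
    simpa using hu
  set G : UnitAddCircle → ℂ := fun x => ∫ u in Set.Icc (0 : ℝ) 1, g (x, u) with hG
  have hGm : Measurable G := by
    have : StronglyMeasurable (Function.uncurry fun x u => g (x, u)) := hgm.stronglyMeasurable
    exact (this.integral_prod_right (ν := volume.restrict (Set.Icc (0 : ℝ) 1))).measurable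
  have hgG : ∀ᵐ x : UnitAddCircle, ∀ᵐ u : ℝ, g (x, u) = G x := by
    filter_upwards [hgx] with x hx
    obtain ⟨k, hk⟩ := hx
    have : G x = k := by
      simp only [hG]
      rw [integral_congr_ae (ae_restrict_of_ae hk)]
      simp
    rwa [this]
  refine ⟨G, hGm, ?_, ?_⟩
  · filter_upwards [hgG, (measurePreserving_rotation
      (α : UnitAddCircle)).quasiMeasurePreserving.ae hgG] with x h1 h2
    have h3 := (measurePreserving_add_right (volume : Measure ℝ) (-φ x)).quasiMeasurePreserving.ae h2
    obtain ⟨u, k1, k2⟩ := (h1.and h3).exists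
    have e : act α φ 1 (x, u) = (x + (α : UnitAddCircle), u + -φ x) := by
      simp [act, birkhoff_one, sub_eq_add_neg]
    rw [← k1, ← k2, ← e]
    simp only [hg]
    rw [hFinv, ← mul_assoc, ← Complex.exp_add, e]
    congr 2
    push_cast
    ring
  · have hprod : ∀ᵐ p : UnitAddCircle × ℝ, g p = G p.1 := by
      refine (Measure.ae_prod_iff_ae_ae ?_).2 hgG
      exact measurableSet_eq_fun hgm (hGm.comp measurable_fst)
    filter_upwards [ae_restrict_of_ae hprod, hff', ae_mem_region hφ] with p h1 h2 h3
    have h4 := hFg p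
    rw [h1] at h4
    rw [h2, ← h4]
    simp only [hF]
    rw [proj_of_mem hφ hpos h3]

lemma ergodic_rotation {α : ℝ} (hα : Irrational α) :
    Ergodic (fun x : UnitAddCircle => x + (α : UnitAddCircle)) volume := by
  rw [AddCircle.ergodic_add_right, addOrderOf_eq_zero_iff']
  intro n hn h
  have := norm_nsmul_pos hα hn.ne'
  rw [h, norm_zero] at this
  exact this.false

theorem weakMixing_of_not_summable {α : ℝ} (hα : Irrational α) {φ : UnitAddCircle → ℝ}
    (hφ : ContDiff ℝ 3 (fun x : ℝ => φ (x : UnitAddCircle))) (hpos : ∀ x, 0 < φ x) (h1 : H1 φ)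
    (hns : ¬ Summable fun m : ℤ => ‖formalCoeff α φ m‖ ^ 2) :
    WeakMixing (flow α φ) (flowMeasure φ) := by
  have hφc : Continuous φ := continuous_of_continuous_coe hφ.continuous
  intro ν f hf hfe
  obtain ⟨G, hGm, hG, hfG⟩ := exists_cocycle_of_eigenfunction hφc hpos hf.1 hfe
  have herg := ergodic_rotation hα
  by_cases hν : ν = 0
  · subst hν
    obtain ⟨k, hk⟩ := herg.ae_eq_const_of_ae_eq_comp₀ hGm.nullMeasurable (by
      filter_upwards [hG] with x hx
      simpa using hx)
    refine ⟨k, ?_⟩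
    filter_upwards [hfG, ae_flowMeasure_of_ae (φ := φ) hk] with p hp hk
    rw [hp, hk]
    simp
  · obtain ⟨r, hr⟩ := herg.ae_eq_const_of_ae_eq_comp₀ (g := fun x => ‖G x‖) hGm.norm.nullMeasurable (by
      filter_upwards [hG] with x hx
      simp only [Function.comp]
      rw [hx, norm_mul, norm_exp_eq_one, one_mul])
    by_cases hr0 : r = 0
    · refine ⟨0, ?_⟩
      filter_upwards [hfG, ae_flowMeasure_of_ae (φ := φ) hr] with p hp hk
      rw [hr0, Function.const_apply, norm_eq_zero] at hk
      rw [hp, hk, mul_zero]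
    · refine absurd (summable_formalCoeff_of_cocycle hα hφ h1 hν (G := fun x => (r : ℂ)⁻¹ * G x)
        (hGm.const_mul _) ?_ ?_) hns
      · filter_upwards [hr] with x hx
        rw [Function.const_apply] at hx
        have hr1 : 0 ≤ r := hx ▸ norm_nonneg _
        rw [norm_mul, hx, norm_inv, Complex.norm_real, Real.norm_eq_abs, abs_of_nonneg hr1,
          inv_mul_cancel₀ hr0]
      · filter_upwards [hG] with x hx
        rw [hx]
        ring

end SpecialFlow

end

theorem theorem2p1 (φ : UnitAddCircle → ℝ)
    (hφ : ContDiff ℝ 3 (fun x : ℝ => φ (x : UnitAddCircle)))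
    (hpos : ∀ x, 0 < φ x)
    (h1 : SpecialFlow.H1 φ) (h2 : SpecialFlow.H2 φ) (h3 : SpecialFlow.H3 φ)
    (α : ℝ) (hα : Irrational α) :
    Xor (SpecialFlow.WeakMixing (SpecialFlow.flow α φ) (SpecialFlow.flowMeasure φ))
      (SpecialFlow.L2ConjugateToSuspension α φ) ∧
    (SpecialFlow.L2ConjugateToSuspension α φ ↔
      Summable (fun m : ℤ => ‖SpecialFlow.formalCoeff α φ m‖ ^ 2)) := by
  have hφc : Continuous φ := SpecialFlow.continuous_of_continuous_coe hφ.continuous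
  have hiff : SpecialFlow.L2ConjugateToSuspension α φ ↔
      Summable (fun m : ℤ => ‖SpecialFlow.formalCoeff α φ m‖ ^ 2) :=
    ⟨SpecialFlow.summable_of_l2ConjugateToSuspension hα hφc hpos,
      SpecialFlow.l2ConjugateToSuspension_of_summable hα hφc hpos⟩
  refine ⟨?_, hiff⟩
  by_cases hs : SpecialFlow.L2ConjugateToSuspension α φ
  · have hs' := hs
    obtain ⟨c, hc, h, ψ, hconj, -, -⟩ := hs'
    exact Or.inr ⟨hs, SpecialFlow.not_weakMixing_of_isConjugacy hc hconj⟩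
  · exact Or.inl ⟨SpecialFlow.weakMixing_of_not_summable hα hφ hpos h1
      (fun h => hs (hiff.2 h)), hs⟩
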